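/- **Setting.** Let $\mathcal X\subset\mathbb R^{d_0}$ be bounded, $B_x=\sup_{x\in\mathcal X}\|x\|_2$. Let $\nu$ be a discrete probability measure on a set of latent classes with $\nu(c)<1$ for every class $c$, let $\mathcal D_c$ be a probability distribution on $\mathcal X$ for each $c$, and let $\bar{\mathcal D}_c=\sum_{z\ne c}\nu(z)\mathcal D_z\big/\sum_{z\neq c}\nu(z)$. A random tuple $(x,x^+,x_1^-,\dots,x_k^-)$ is generated by drawing $c\sim\nu$ and then, independently given $c$, $x,x^+\sim\mathcal D_c$ and $x_1^-,\dots,x_k^-\sim\bar{\mathcal D}_c$. Let $\mathcal S=(\mathbf X_1,\dots,\mathbf X_n)$, $n\ge 1$, consist of i.i.d. such tuples $\mathbf X_j=(x_j,x_j^+,x_{j1}^-,\dots,x_{jk}^-)$. For a loss $\ell:\mathbb R^k\to[0,1]$ and a map $f$ put $$\mathrm L_{\mathrm{un}}(f)=\mathbb E\,\ell\big(\{f(x)^\top(f(x^+)-f(x_i^-))\}_{i=1}^k\big),\qquad \widehat{\mathrm L}_{\mathrm{un}}(f)=\frac1n\sum_{j=1}^n\ell\big(\{f(x_j)^\top(f(x_j^+)-f(x_{ji}^-))\}_{i=1}^k\big).$$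 Let $L\ge1$, let $M^{(l)}\in\mathbb R^{d_l\times d_{l-1}}$ be fixed matrices, $a_l,s_l>0$, and let $\sigma_l:\mathbb R^{d_l}\to\mathbb R^{d_l}$ be $\rho_l$-Lipschitz for the Euclidean norm with $\sigma_l(0)=0$ ($1\le l\le L$). Let $\mathcal A$ be the set of all $\mathbf A=(A^{(1)},\dots,A^{(L)})$, $A^{(l)}\in\mathbb R^{d_l\times d_{l-1}}$, with spectral norm $\|A^{(l)}\|_\sigma\le s_l$ and $\|(A^{(l)}-M^{(l)})^\top\|_{2,1}\le a_l$, where $\|\cdot\|_{2,1}$ is the sum of the Euclidean norms of the columns. Put $F_{\mathbf A}(x)=\sigma_L(A^{(L)}\sigma_{L-1}(\cdots\sigma_1(A^{(1)}x)\cdots))$, $W=\max_{1\le l\le L}d_l$, and let $\mathcal I_{\mathbf A,R}$ be the number of indices $j\le n$ for which some vector $\tilde x$ of the tuple $\mathbf X_j$ has $\|F_{\mathbf A}(\tilde x)\|_2>R$. **Theorem.** There are absolute constants $C>0$ and $p\in\mathbb N$ such that the following holds in every such setting. Let $\ell:\mathbb R^k\to[0,1]$ satisfy $|\ell(v)-\ell(\bar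 v)|\le\eta\|v-\bar v\|_\infty$ for all $v,\bar v$, with $\eta\ge1$, let $R\ge1$ and $\delta\in(0,1)$. Then with probability at least $1-\delta$ over $\mathcal S$, simultaneously for all $\mathbf A\in\mathcal A$, $$\mathrm L_{\mathrm{un}}(F_{\mathbf A})-\widehat{\mathrm L}_{\mathrm{un}}(F_{\mathbf A})\le\frac{\mathcal I_{\mathbf A,R}}{n}+3\sqrt{\frac{\log(2/\delta)}{2n}}+C\log^p\!\big(n(k+2)\big)\,\frac{\eta RB_x}{\sqrt n}\,\log(\max\{W,2\})\prod_{m=1}^L\rho_ms_m\left[\sum_{l=1}^L\frac{a_l^{2/3}}{s_l^{2/3}}\right]^{3/2}.$$ -/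

import Mathlib

open MeasureTheory

namespace Contrastive

/-- `ℝᵐ` with the Euclidean norm. -/
abbrev Vec (m : ℕ) := EuclideanSpace ℝ (Fin m)

/-- An input tuple `(x, x⁺, (x₁⁻, …, x_k⁻))` of vectors of `ℝᵐ`. -/
abbrev InputTuple (m k : ℕ) := Vec m × Vec m × (Fin k → Vec m)

/-- The set of the `k + 2` vectors that occur in an input tuple. -/
def entries {m k : ℕ} (t : InputTuple m k) : Set (Vec m) :=
  {t.1, t.2.1} ∪ Set.range t.2.2

/-! ### The distribution of the tuples -/

/-- The law of a sample given that its latent class is not `c`: the mixture of the class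
distributions `D z`, `z ≠ c`, with weights proportional to `prior z`. -/
noncomputable def negLaw {𝒞 : Type*} {m : ℕ} (prior : PMF 𝒞) (D : 𝒞 → Measure (Vec m)) (c : 𝒞) :
    Measure (Vec m) :=
  (∑' z : {z : 𝒞 // z ≠ c}, prior z)⁻¹ • Measure.sum fun z : {z : 𝒞 // z ≠ c} => prior z • D z

/-- The law of an input tuple: draw a latent class `c` from `prior`, then `x, x⁺` independently
from `D c` and, independently of these, `k` independent negative samples from `negLaw prior D c`. -/
noncomputable def tupleLaw {𝒞 : Type*} {m : ℕ} (prior : PMF 𝒞) (D : 𝒞 → Measure (Vec m)) (k : ℕ) :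
    Measure (InputTuple m k) :=
  Measure.sum fun c =>
    prior c • (D c).prod ((D c).prod (Measure.pi fun _ : Fin k => negLaw prior D c))

/-! ### The unsupervised risks -/

/-- The vector `(f(x)ᵀ (f(x⁺) - f(x_i⁻)))_{i ≤ k}`. -/
noncomputable def margins {m q k : ℕ} (f : Vec m → Vec q) (t : InputTuple m k) : Fin k → ℝ :=
  fun i => inner ℝ (f t.1) (f t.2.1 - f (t.2.2 i))

/-- The population unsupervised risk of `f` for tuples with law `μ`. -/
noncomputable def popRisk {m q k : ℕ} (loss : (Fin k → ℝ) → ℝ) (μ : Measure (InputTuple m k))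
    (f : Vec m → Vec q) : ℝ :=
  ∫ t, loss (margins f t) ∂μ

/-- The empirical unsupervised risk of `f` on the sample `S` of `n` tuples. -/
noncomputable def empRisk {m q k n : ℕ} (loss : (Fin k → ℝ) → ℝ) (S : Fin n → InputTuple m k)
    (f : Vec m → Vec q) : ℝ :=
  (∑ j, loss (margins f (S j))) / n

/-- The number of tuples of the sample that contain a vector `x` with `‖f x‖ > R`. -/
noncomputable def exceedCount {m q k n : ℕ} (S : Fin n → InputTuple m k) (f : Vec m → Vec q)
    (R : ℝ) : ℕ :=
  {j : Fin n | ∃ x ∈ entries (S j), R < ‖f x‖}.ncard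

/-! ### The neural networks -/

/-- The spectral norm of a matrix: its operator norm for the Euclidean norms. -/
noncomputable def specNorm {p q : ℕ} (A : Matrix (Fin p) (Fin q) ℝ) : ℝ :=
  ‖LinearMap.toContinuousLinearMap (Matrix.toEuclideanLin A)‖

/-- The `(2,1)` norm of a matrix: the sum of the Euclidean norms of its columns. -/
noncomputable def norm21 {p q : ℕ} (A : Matrix (Fin p) (Fin q) ℝ) : ℝ :=
  ∑ j, ‖(WithLp.toLp 2 (fun i => A i j) : Vec p)‖

/-- Weight matrices of an `L`-layer network with layer widths `d 0, …, d L`. The index `l : Fin L`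
stands for the `(l+1)`-st layer, which maps `ℝ^(d l)` to `ℝ^(d (l+1))`. -/
abbrev Weights {L : ℕ} (d : Fin (L + 1) → ℕ) :=
  (l : Fin L) → Matrix (Fin (d l.succ)) (Fin (d l.castSucc)) ℝ

/-- The weights whose spectral norms are at most `s l` and whose transposed deviations from the
reference matrices `M l` have `(2,1)` norm at most `a l`. -/
def weightSpace {L : ℕ} {d : Fin (L + 1) → ℕ} (M : Weights d) (a s : Fin L → ℝ) :
    Set (Weights d) :=
  {A | ∀ l, specNorm (A l) ≤ s l ∧ norm21 (A l - M l).transpose ≤ a l}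

/-- The output of the first `i` layers of the network with activations `act` and weights `A`. -/
noncomputable def layerOutput {L : ℕ} {d : Fin (L + 1) → ℕ}
    (act : (l : Fin L) → Vec (d l.succ) → Vec (d l.succ)) (A : Weights d) (x : Vec (d 0))
    (i : Fin (L + 1)) : Vec (d i) :=
  Fin.induction (motive := fun i => Vec (d i)) x
    (fun l z => act l (Matrix.toEuclideanLin (A l) z)) i

/-- The network `x ↦ σ_L (A_L σ_{L-1} (… σ_1 (A_1 x) …))`. -/
noncomputable def network {L : ℕ} {d : Fin (L + 1) → ℕ}
    (act : (l : Fin L) → Vec (d l.succ) → Vec (d l.succ)) (A : Weights d) (x : Vec (d 0)) :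
    Vec (d (Fin.last L)) :=
  layerOutput act A x (Fin.last L)

/-- The maximal width of the layers `1, …, L`. -/
def maxWidth {L : ℕ} (d : Fin (L + 1) → ℕ) : ℕ :=
  Finset.univ.sup fun l : Fin L => d l.succ

/-- The radius `sup_{x ∈ 𝒳} ‖x‖` of the input space. -/
noncomputable def inputRadius {m : ℕ} (𝒳 : Set (Vec m)) : ℝ :=
  sSup ((fun x => ‖x‖) '' 𝒳)

end Contrastive

/-!
The loss is replaced by an augmented loss `augLoss` of the network outputs on the `k + 2` vectors of
a tuple. It dominates the loss, exceeds it only when one of the outputs is longer than `R`, and is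
`9 η R`-Lipschitz for the maximum over the `k + 2` outputs of the Euclidean distance. The first two
properties produce the term `exceedCount / n`; the maximum is what keeps the dependence on `k`
logarithmic, since covering numbers are then needed only for the maximum over the `n (k + 2)`
vectors of the sample.

For a matrix class such a covering number comes from the perceptron algorithm: a vector `z` is
approximated, uniformly over data in a ball of radius `b`, by a signed sum of few data vectors
(`exists_perceptron_word`). If the rows of a matrix have lengths with sum at most `a`, the row `i`
gets a number of summands proportional to its length, and the matrix is coded by a word of length
`O(a² b² / ε²)` over an alphabet of size `O(W n (k + 2))` (`exists_matrix_cover`). As the step sizes are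
read off from the word itself, no further logarithm of `a b / ε` occurs. The layers are composed
with centres that belong to the class, hence have controlled spectral norms, and the accuracy is
distributed over the layers in proportion to `(a_l / s_l)^(2/3)`: the logarithm of the covering
number at scale `ε` is `O(Γ² / ε²)` times the logarithm of the alphabet, where
`Γ = B ∏ ρ_l s_l (∑ (a_l / s_l)^(2/3))^(3/2)` (`exists_network_cover`). Because lengths are integers,
a single centre is enough at a scale comparable with `Γ`, so that chaining can start there and
costs `O(log n)` steps (`signAvg_sup_le`).

For finitely many networks, symmetrization (`integral_maxDeviation_le`) bounds the expected maximal
deviation by the chaining bound, and the bounded differences inequality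
(`measure_bounded_differences_le`) gives the confidence statement, with the constant `1` in place
of the admissible `3`. The whole class is reached from its finite subsets by continuity in the
weights (`measure_exists_deviation_le`), which also settles the measurability of the supremum.
-/

namespace Contrastive

/-! ### Covering numbers of matrix classes -/

/-- Letters of the code of a vector: `none` is a padding letter, `some (true, j)` stands for the
data vector `x j` and `some (false, j)` for its negative. -/
def letterVec {κ E : Type*} [AddCommGroup E] (x : κ → E) : Option (Bool × κ) → E
  | none => 0
  | some (true, j) => x j
  | some (false, j) => -x j

theorem perceptron_step {E : Type*} [NormedAddCommGroup E] [InnerProductSpace ℝ E]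
    {b ε : ℝ} (hb : 0 < b) (hε : 0 < ε) {z y : E} (hy : ‖y‖ ≤ b) (h : ε < inner ℝ z y) :
    ‖z - (ε / b ^ 2) • y‖ ^ 2 * b ^ 2 ≤ ‖z‖ ^ 2 * b ^ 2 - ε ^ 2 := by
  have h1 : ‖z - (ε / b ^ 2) • y‖ ^ 2
      = ‖z‖ ^ 2 - 2 * (ε / b ^ 2 * inner ℝ z y) + (ε / b ^ 2) ^ 2 * ‖y‖ ^ 2 := by
    rw [norm_sub_sq_real, inner_smul_right, norm_smul, mul_pow, Real.norm_eq_abs, sq_abs]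
  have h2 : ‖y‖ ^ 2 ≤ b ^ 2 := by gcongr
  have h3 : (ε / b ^ 2) ^ 2 * ‖y‖ ^ 2 ≤ (ε / b ^ 2) ^ 2 * b ^ 2 := by gcongr
  have h4 : ε / b ^ 2 * ε ≤ ε / b ^ 2 * inner ℝ z y := by gcongr
  calc ‖z - (ε / b ^ 2) • y‖ ^ 2 * b ^ 2
      ≤ (‖z‖ ^ 2 - 2 * (ε / b ^ 2 * ε) + (ε / b ^ 2) ^ 2 * b ^ 2) * b ^ 2 := by
        gcongr; linarith
    _ = ‖z‖ ^ 2 * b ^ 2 - ε ^ 2 := by field_simp; ring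

/-- Perceptron argument: every mistake `ε < |⟪z - z', x j⟫|` of the current approximation `z'` is
answered by adding `± (ε / b²) x j` to it, which lowers `‖z - z'‖² b²` by at least `ε²`; hence `m`
corrections suffice as soon as `‖z‖² b² < (m + 1) ε²`. -/
theorem exists_perceptron_word {κ E : Type*} [NormedAddCommGroup E] [InnerProductSpace ℝ E]
    {b ε : ℝ} (hb : 0 < b) (hε : 0 < ε) (x : κ → E) (hx : ∀ j, ‖x j‖ ≤ b) (m : ℕ) (z : E)
    (hz : ‖z‖ ^ 2 * b ^ 2 < (m + 1) * ε ^ 2) :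
    ∃ w : Fin m → Option (Bool × κ),
      ∀ j, |inner ℝ (z - (ε / b ^ 2) • ∑ t, letterVec x (w t)) (x j)| ≤ ε := by
  induction m generalizing z with
  | zero =>
    refine ⟨fun _ => none, fun j => ?_⟩
    have h : ‖z‖ * b < ε := by
      refine lt_of_pow_lt_pow_left₀ 2 hε.le ?_
      rw [mul_pow]; simpa using hz
    simp only [Finset.univ_eq_empty, Finset.sum_empty, smul_zero, sub_zero]
    calc |inner ℝ z (x j)| ≤ ‖z‖ * ‖x j‖ := abs_real_inner_le_norm _ _
      _ ≤ ‖z‖ * b := by gcongr; exact hx j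
      _ ≤ ε := h.le
  | succ m ih =>
    by_cases hall : ∀ j, |inner ℝ z (x j)| ≤ ε
    · exact ⟨fun _ => none, fun j => by simpa [letterVec] using hall j⟩
    · push Not at hall
      obtain ⟨j₀, hj₀⟩ := hall
      obtain ⟨l, hl, hlz⟩ : ∃ l : Option (Bool × κ), ‖letterVec x l‖ ≤ b ∧
          ε < inner ℝ z (letterVec x l) := by
        rcases lt_abs.1 hj₀ with h | h
        · exact ⟨some (true, j₀), hx j₀, h⟩
        · refine ⟨some (false, j₀), ?_, ?_⟩
          · simpa [letterVec] using hx j₀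
          · simpa [letterVec, inner_neg_right] using h
      obtain ⟨w, hw⟩ := ih (z - (ε / b ^ 2) • letterVec x l) (by
        have := perceptron_step hb hε hl hlz
        push_cast at hz
        nlinarith)
      refine ⟨Fin.cons l w, fun j => ?_⟩
      have := hw j
      rw [Fin.sum_univ_succ]
      simp only [Fin.cons_zero, Fin.cons_succ, smul_add]
      rwa [← sub_sub]

/-- The row-wise decoding of a word whose letters are labelled by rows: the row with index `i` is
the sum of its letters, with a step size that depends on the number `m` of its letters. -/
noncomputable def decodeRow {ι κ E : Type*} [DecidableEq ι] [NormedAddCommGroup E]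
    [InnerProductSpace ℝ E] (b θ : ℝ) (x : κ → E) {T : ℕ}
    (w : Fin T → Option (ι × Option (Bool × κ))) (i : ι) : E :=
  (b * √((∑ t, if (w t).map Prod.fst = some i then (1 : ℝ) else 0) + 1) / θ / b ^ 2) •
    ∑ t, (w t).elim 0 fun l => if l.1 = i then letterVec x l.2 else 0

/-- Approximation of a family of vectors `z i` with `∑ ‖z i‖ ≤ a`, in the `ℓ²` norm over `i` of
the inner products and uniformly over the data `x j`. The row `i` receives `⌊θ ‖z i‖⌋` letters. -/
theorem exists_word_decodeRow {ι κ E : Type*} [Fintype ι] [DecidableEq ι] [NormedAddCommGroup E]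
    [InnerProductSpace ℝ E] {b θ a : ℝ} (hb : 0 < b) (hθ : 0 < θ)
    (x : κ → E) (hx : ∀ j, ‖x j‖ ≤ b) (z : ι → E) (hz : ∑ i, ‖z i‖ ≤ a) :
    ∃ w : Fin ⌊θ * a⌋₊ → Option (ι × Option (Bool × κ)),
      ∀ j, ∑ i, (inner ℝ (z i - decodeRow b θ x w i) (x j)) ^ 2 ≤ 2 * a * b ^ 2 / θ := by
  set m : ι → ℕ := fun i => ⌊θ * ‖z i‖⌋₊ with hm
  have hm_le : ∀ i, (m i : ℝ) ≤ θ * ‖z i‖ := fun i => Nat.floor_le (by positivity)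
  have hm_lt : ∀ i, θ * ‖z i‖ < m i + 1 := fun i => Nat.lt_floor_add_one _
  have hε : ∀ i, 0 < b * √((m i : ℝ) + 1) / θ := fun i => by positivity
  have hrow : ∀ i, ∃ w : Fin (m i) → Option (Bool × κ), ∀ j,
      |inner ℝ (z i - (b * √((m i : ℝ) + 1) / θ / b ^ 2) • ∑ t, letterVec x (w t)) (x j)|
        ≤ b * √((m i : ℝ) + 1) / θ := fun i => by
    refine exists_perceptron_word hb (hε i) x hx (m i) (z i) ?_
    rw [div_pow, mul_pow, Real.sq_sqrt (by positivity)]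
    have h1 : (θ * ‖z i‖) ^ 2 < (m i + 1) ^ 2 := by
      have := hm_lt i
      gcongr
    rw [← mul_div_assoc, lt_div_iff₀ (by positivity)]
    have hb2 : 0 < b ^ 2 := by positivity
    nlinarith
  choose w hw using hrow
  -- the words of the rows are merged into one word of length `⌊θ a⌋`
  have hcard : Fintype.card (Σ i, Fin (m i)) ≤ Fintype.card (Fin ⌊θ * a⌋₊) := by
    rw [Fintype.card_sigma, Fintype.card_fin]
    refine Nat.le_floor ?_
    push_cast
    calc ∑ i, ((Fintype.card (Fin (m i)) : ℕ) : ℝ) ≤ ∑ i, θ * ‖z i‖ :=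
          Finset.sum_le_sum fun i _ => by simpa using hm_le i
      _ = θ * ∑ i, ‖z i‖ := by rw [Finset.mul_sum]
      _ ≤ θ * a := by gcongr
  obtain ⟨e⟩ := Function.Embedding.nonempty_of_card_le hcard
  set W : Fin ⌊θ * a⌋₊ → Option (ι × Option (Bool × κ)) :=
    Function.extend e (fun p : Σ i, Fin (m i) => some (p.1, w p.1 p.2)) (fun _ => none) with hW
  have hWe : ∀ p, W (e p) = some (p.1, w p.1 p.2) := fun p => e.injective.extend_apply _ _ _
  have hWn : ∀ t, t ∉ Set.range e → W t = none := fun t ht =>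
    Function.extend_apply' _ _ _ fun ⟨p, hp⟩ => ht ⟨p, hp⟩
  have hcount : ∀ i, (∑ t, if (W t).map Prod.fst = some i then (1 : ℝ) else 0) = m i := fun i => by
    rw [← Fintype.sum_of_injective e e.injective
      (fun p : Σ i, Fin (m i) => if p.1 = i then (1 : ℝ) else 0) _
      (fun t ht => by simp [hWn t ht]) (fun p => by simp [hWe p])]
    rw [Fintype.sum_sigma, Finset.sum_eq_single i]
    · simp
    · intro i' _ hi'; simp [hi']
    · simp
  have hsum : ∀ i, (∑ t, (W t).elim 0 fun l => if l.1 = i then letterVec x l.2 else 0)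
      = ∑ t, letterVec x (w i t) := fun i => by
    rw [← Fintype.sum_of_injective e e.injective
      (fun p : Σ i, Fin (m i) => if p.1 = i then letterVec x (w p.1 p.2) else 0) _
      (fun t ht => by simp [hWn t ht]) (fun p => by simp [hWe p])]
    rw [Fintype.sum_sigma, Finset.sum_eq_single i]
    · simp
    · intro i' _ hi'; simp [hi']
    · simp
  refine ⟨W, fun j => ?_⟩
  have hterm : ∀ i, (inner ℝ (z i - decodeRow b θ x W i) (x j)) ^ 2
      ≤ 2 * b ^ 2 / θ * ‖z i‖ := fun i => by
    have hdec : decodeRow b θ x W i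
        = (b * √((m i : ℝ) + 1) / θ / b ^ 2) • ∑ t, letterVec x (w i t) := by
      rw [decodeRow, hcount, hsum]
    rw [hdec]
    rcases Nat.eq_zero_or_pos (m i) with h0 | h0
    · -- a row without letters is decoded to `0`, and `θ ‖z i‖ < 1`
      have hs : ∑ t, letterVec x (w i t) = 0 := by
        have : IsEmpty (Fin (m i)) := by rw [h0]; infer_instance
        exact Finset.sum_of_isEmpty _ 
      rw [hs, smul_zero, sub_zero]
      have h1 : θ * ‖z i‖ ≤ 1 := by have := hm_lt i; rw [h0] at this; simpa using this.le
      have h2 : (inner ℝ (z i) (x j)) ^ 2 ≤ (‖z i‖ * b) ^ 2 := by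
        refine sq_le_sq' ?_ ?_
        · have := (abs_le.1 (abs_real_inner_le_norm (z i) (x j))).1
          have : ‖z i‖ * ‖x j‖ ≤ ‖z i‖ * b := by gcongr; exact hx j
          linarith
        · exact (real_inner_le_norm _ _).trans (by gcongr; exact hx j)
      refine h2.trans ?_
      rw [div_mul_eq_mul_div, le_div_iff₀ hθ]
      have : 0 ≤ b ^ 2 * ‖z i‖ := by positivity
      nlinarith
    · have h1 : (1 : ℝ) ≤ m i := by exact_mod_cast h0
      have h2 := sq_le_sq' (abs_le.1 (hw i j)).1 (abs_le.1 (hw i j)).2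
      refine h2.trans ?_
      rw [div_pow, mul_pow, Real.sq_sqrt (by positivity), div_le_iff₀ (by positivity)]
      have h3 : (m i : ℝ) + 1 ≤ 2 * (θ * ‖z i‖) := by linarith [hm_le i]
      calc b ^ 2 * ((m i : ℝ) + 1) ≤ b ^ 2 * (2 * (θ * ‖z i‖)) := by gcongr
        _ = 2 * b ^ 2 / θ * ‖z i‖ * θ ^ 2 := by field_simp
  calc ∑ i, (inner ℝ (z i - decodeRow b θ x W i) (x j)) ^ 2
      ≤ ∑ i, 2 * b ^ 2 / θ * ‖z i‖ := Finset.sum_le_sum fun i _ => hterm i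
    _ = 2 * b ^ 2 / θ * ∑ i, ‖z i‖ := by rw [Finset.mul_sum]
    _ ≤ 2 * b ^ 2 / θ * a := by gcongr
    _ = 2 * a * b ^ 2 / θ := by ring

theorem norm_toEuclideanLin_le {p q : ℕ} (A : Matrix (Fin p) (Fin q) ℝ) (x : Vec q) :
    ‖Matrix.toEuclideanLin A x‖ ≤ specNorm A * ‖x‖ :=
  (LinearMap.toContinuousLinearMap (Matrix.toEuclideanLin A)).le_opNorm x

theorem toEuclideanLin_apply_eq_inner {p q : ℕ} (A : Matrix (Fin p) (Fin q) ℝ) (x : Vec q)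
    (i : Fin p) : Matrix.toEuclideanLin A x i = inner ℝ (WithLp.toLp 2 (A i) : Vec q) x := by
  simp [Matrix.toLpLin_apply, Matrix.mulVec, dotProduct, PiLp.inner_apply, mul_comm]

/-- The matrices with spectral norm at most `s` whose rows deviate from those of `M` by at most `a`
in the sum of the Euclidean norms: one factor of the weight space. -/
def matrixBall {p q : ℕ} (M : Matrix (Fin p) (Fin q) ℝ) (a s : ℝ) :
    Set (Matrix (Fin p) (Fin q) ℝ) :=
  {A | specNorm A ≤ s ∧ norm21 (A - M).transpose ≤ a}

/-- Covering number of `matrixBall M a s`, for the maximum over the data of the Euclidean distance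
of the outputs, at the scale `s * b * τ`. The centres belong to the ball, so that their spectral
norms are under control when layers are composed. -/
theorem exists_matrix_cover {p q : ℕ} {κ : Type*} [Fintype κ] (M : Matrix (Fin p) (Fin q) ℝ)
    {a s b τ : ℝ} (ha : 0 < a) (hs : 0 < s) (hτ : 0 < τ)
    (x : κ → Vec q) (hx : ∀ j, ‖x j‖ ≤ b) :
    ∃ G : Finset (Matrix (Fin p) (Fin q) ℝ),
      G.card ≤ (p * (2 * Fintype.card κ + 1) + 1) ^ ⌊8 * (a / s) ^ 2 / τ ^ 2⌋₊ ∧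
      (∀ A ∈ G, A ∈ matrixBall M a s) ∧
      ∀ A ∈ matrixBall M a s, ∃ A' ∈ G, ∀ j,
        ‖Matrix.toEuclideanLin A (x j) - Matrix.toEuclideanLin A' (x j)‖ ≤ s * b * τ := by
  classical
  by_cases hb : 0 < b
  swap
  · -- all data vanish, so that one centre is enough
    have hx0 : ∀ j, x j = 0 := fun j => by
      have := hx j
      have h0 := norm_nonneg (x j)
      exact norm_le_zero_iff.1 (by linarith)
    by_cases hne : (matrixBall M a s).Nonempty
    · obtain ⟨A₀, hA₀⟩ := hne
      refine ⟨{A₀}, ?_, by simpa using hA₀, fun A _ => ⟨A₀, by simp, fun j => ?_⟩⟩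
      · simpa using Nat.one_le_pow _ _ (Nat.succ_pos _)
      · have : 0 ≤ b := (norm_nonneg _).trans (hx j)
        simp only [hx0 j, map_zero, sub_zero, norm_zero]
        positivity
    · exact ⟨∅, by simp, by simp, fun A hA => (hne ⟨A, hA⟩).elim⟩
  set θ : ℝ := 8 * a / (s ^ 2 * τ ^ 2) with hθdef
  have hθ : 0 < θ := by positivity
  have hT : θ * a = 8 * (a / s) ^ 2 / τ ^ 2 := by rw [hθdef]; field_simp
  rw [← hT]
  set near : (Fin ⌊θ * a⌋₊ → Option (Fin p × Option (Bool × κ))) →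
      Matrix (Fin p) (Fin q) ℝ → Prop := fun w A => ∀ j,
    ∑ i, (inner ℝ ((WithLp.toLp 2 ((A - M) i) : Vec q) - decodeRow b θ x w i) (x j)) ^ 2
      ≤ (s * b * τ / 2) ^ 2 with hnear
  have hcov : ∀ A ∈ matrixBall M a s, ∃ w, near w A := fun A hA => by
    obtain ⟨w, hw⟩ := exists_word_decodeRow hb hθ x hx
      (fun i => (WithLp.toLp 2 ((A - M) i) : Vec q)) hA.2
    refine ⟨w, fun j => (hw j).trans (le_of_eq ?_)⟩
    rw [hθdef]; field_simp; ring
  choose! code hcode using hcov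
  set rep : (Fin ⌊θ * a⌋₊ → Option (Fin p × Option (Bool × κ))) → Matrix (Fin p) (Fin q) ℝ :=
    fun w => if h : ∃ A ∈ matrixBall M a s, near w A then h.choose else 0 with hrep
  have hrep_spec : ∀ w, (∃ A ∈ matrixBall M a s, near w A) →
      rep w ∈ matrixBall M a s ∧ near w (rep w) := fun w h => by
    simp only [hrep, dif_pos h]; exact h.choose_spec
  refine ⟨(Finset.univ.filter fun w => ∃ A ∈ matrixBall M a s, near w A).image rep, ?_, ?_, ?_⟩
  · refine Finset.card_image_le.trans ((Finset.card_filter_le _ _).trans (le_of_eq ?_))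
    simp [Finset.card_univ, Fintype.card_option, Fintype.card_prod]
  · intro A hA
    simp only [Finset.mem_image, Finset.mem_filter, Finset.mem_univ, true_and] at hA
    obtain ⟨w, hw, rfl⟩ := hA
    exact (hrep_spec w hw).1
  · intro A hA
    have hex : ∃ A' ∈ matrixBall M a s, near (code A) A' := ⟨A, hA, hcode A hA⟩
    refine ⟨rep (code A), Finset.mem_image_of_mem _ (by simpa using hex), fun j => ?_⟩
    -- both matrices are within half the scale of the decoded word
    set y : Vec p := WithLp.toLp 2 fun i => inner ℝ
      ((WithLp.toLp 2 (M i) : Vec q) + decodeRow b θ x (code A) i) (x j) with hy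
    have hhalf : ∀ A', near (code A) A' →
        ‖Matrix.toEuclideanLin A' (x j) - y‖ ≤ s * b * τ / 2 := fun A' hA' => by
      rw [EuclideanSpace.norm_eq]
      refine Real.sqrt_le_iff.2 ⟨by positivity, le_of_eq_of_le ?_ (hA' j)⟩
      refine Finset.sum_congr rfl fun i _ => ?_
      rw [PiLp.sub_apply, toEuclideanLin_apply_eq_inner, hy, Real.norm_eq_abs, sq_abs]
      simp only
      rw [← inner_sub_left, ← sub_sub]
      rfl
    calc ‖Matrix.toEuclideanLin A (x j) - Matrix.toEuclideanLin (rep (code A)) (x j)‖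
        ≤ ‖Matrix.toEuclideanLin A (x j) - y‖
          + ‖Matrix.toEuclideanLin (rep (code A)) (x j) - y‖ := by
          rw [norm_sub_rev (Matrix.toEuclideanLin (rep (code A)) (x j)) y]
          exact norm_sub_le_norm_sub_add_norm_sub _ _ _
      _ ≤ s * b * τ / 2 + s * b * τ / 2 :=
          add_le_add (hhalf A (hcode A hA)) (hhalf _ (hrep_spec _ hex).2)
      _ = s * b * τ := by ring

/-! ### Covering numbers of networks -/

section network
variable {L : ℕ} {d : Fin (L + 1) → ℕ}
  {act : (l : Fin L) → Vec (d l.succ) → Vec (d l.succ)}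

theorem layerOutput_zero (A : Weights d) (x : Vec (d 0)) : layerOutput act A x 0 = x := rfl

theorem layerOutput_succ (A : Weights d) (x : Vec (d 0)) (l : Fin L) :
    layerOutput act A x l.succ
      = act l (Matrix.toEuclideanLin (A l) (layerOutput act A x l.castSucc)) :=
  Fin.induction_succ _ _ _

theorem continuous_layerOutput (hact : ∀ l, Continuous (act l)) (i : Fin (L + 1)) :
    Continuous fun p : Weights d × Vec (d 0) => layerOutput act p.1 p.2 i := by
  induction i using Fin.induction with
  | zero => exact continuous_snd
  | succ l ih =>
    simp only [layerOutput_succ]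
    refine (hact l).comp ?_
    simp only [Matrix.toLpLin_apply]
    refine (PiLp.continuous_toLp 2 _).comp ?_
    refine Continuous.matrix_mulVec ?_ ?_
    · exact (continuous_apply l).comp continuous_fst
    · exact (PiLp.continuous_ofLp 2 _).comp ih

theorem continuous_network (hact : ∀ l, Continuous (act l)) :
    Continuous fun p : Weights d × Vec (d 0) => network act p.1 p.2 :=
  continuous_layerOutput hact _

/-- The layers that precede the position `i`. -/
def layersBefore (i : Fin (L + 1)) : Finset (Fin L) :=
  Finset.univ.filter fun l => l.castSucc < i

theorem layersBefore_zero : layersBefore (0 : Fin (L + 1)) = ∅ := by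
  simp [layersBefore]

theorem layersBefore_succ (l : Fin L) :
    layersBefore l.succ = insert l (layersBefore l.castSucc) := by
  ext m
  simp only [layersBefore, Finset.mem_filter, Finset.mem_univ, true_and, Finset.mem_insert,
    Fin.lt_def, Fin.val_castSucc, Fin.val_succ, Fin.ext_iff]
  omega

theorem notMem_layersBefore (l : Fin L) : l ∉ layersBefore l.castSucc := by
  simp [layersBefore]

theorem layersBefore_last : layersBefore (Fin.last L) = Finset.univ := by
  simp [layersBefore, Fin.castSucc_lt_last]

theorem norm_act_le {ρ : Fin L → NNReal} (hρ : ∀ l, LipschitzWith (ρ l) (act l))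
    (h0 : ∀ l, act l 0 = 0) (l : Fin L) (v : Vec (d l.succ)) : ‖act l v‖ ≤ ρ l * ‖v‖ := by
  have := (hρ l).dist_le_mul v 0
  rwa [h0, dist_zero_right, dist_zero_right] at this

/-- Covering of the outputs of the first layers on finitely many inputs. If `y` is a centre for the
outputs of the layers before `l` and `A'` a centre for the matrices of the layer `l` acting on the
data `y`, then `act l (A' y)` is a centre for the outputs of the layer `l`. -/
theorem exists_layerOutput_cover {κ : Type*} [Fintype κ] (M : Weights d) {a s : Fin L → ℝ}
    {ρ : Fin L → NNReal} (hρ : ∀ l, LipschitzWith (ρ l) (act l)) (h0 : ∀ l, act l 0 = 0)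
    (ha : ∀ l, 0 < a l) (hs : ∀ l, 0 < s l) {B : ℝ} (hB : 0 ≤ B)
    (x : κ → Vec (d 0)) (hx : ∀ j, ‖x j‖ ≤ B) (τ : Fin L → ℝ) (hτ : ∀ l, 0 < τ l)
    {Q : ℕ} (hQ : ∀ l : Fin L, d l.succ * (2 * Fintype.card κ + 1) + 1 ≤ Q) (i : Fin (L + 1)) :
    ∃ C : Finset (κ → Vec (d i)),
      C.card ≤ Q ^ (∑ l ∈ layersBefore i, ⌊8 * (a l / s l) ^ 2 / τ l ^ 2⌋₊) ∧
      (∀ c ∈ C, ∀ j, ‖c j‖ ≤ B * ∏ l ∈ layersBefore i, (ρ l : ℝ) * s l) ∧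
      ∀ A ∈ weightSpace M a s, ∃ c ∈ C, ∀ j, ‖layerOutput act A (x j) i - c j‖
        ≤ (B * ∏ l ∈ layersBefore i, (ρ l : ℝ) * s l) * ∑ l ∈ layersBefore i, τ l := by
  classical
  induction i using Fin.induction with
  | zero =>
    refine ⟨{x}, by simp [layersBefore_zero], by simpa [layersBefore_zero] using hx,
      fun A _ => ⟨x, by simp, fun j => ?_⟩⟩
    simp [layersBefore_zero, layerOutput_zero]
  | succ l ih =>
    obtain ⟨C, hC, hCn, hCc⟩ := ih
    set b : ℝ := B * ∏ m ∈ layersBefore l.castSucc, (ρ m : ℝ) * s m with hb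
    have hb0 : 0 ≤ b := mul_nonneg hB (Finset.prod_nonneg fun m _ => mul_nonneg (ρ m).2 (hs m).le)
    have hbs : B * ∏ m ∈ layersBefore l.succ, (ρ m : ℝ) * s m = ρ l * s l * b := by
      rw [layersBefore_succ, Finset.prod_insert (notMem_layersBefore l), hb]; ring
    have hτs : ∑ m ∈ layersBefore l.succ, τ m = τ l + ∑ m ∈ layersBefore l.castSucc, τ m := by
      rw [layersBefore_succ, Finset.sum_insert (notMem_layersBefore l)]
    have hG : ∀ c : κ → Vec (d l.castSucc), ∃ G : Finset (Matrix (Fin (d l.succ)) _ ℝ),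
        c ∈ C → (G.card ≤ Q ^ ⌊8 * (a l / s l) ^ 2 / τ l ^ 2⌋₊ ∧
          (∀ A ∈ G, A ∈ matrixBall (M l) (a l) (s l)) ∧
          ∀ A ∈ matrixBall (M l) (a l) (s l), ∃ A' ∈ G, ∀ j,
            ‖Matrix.toEuclideanLin A (c j) - Matrix.toEuclideanLin A' (c j)‖
              ≤ s l * b * τ l) := fun c => by
      by_cases hc : c ∈ C
      · obtain ⟨G, h1, h2, h3⟩ := exists_matrix_cover (M l) (ha l) (hs l) (hτ l) c (hCn c hc)
        exact ⟨G, fun _ => ⟨h1.trans (Nat.pow_le_pow_left (hQ l) _), h2, h3⟩⟩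
      · exact ⟨∅, fun h => (hc h).elim⟩
    choose G hG using hG
    refine ⟨C.biUnion fun c => (G c).image fun A j => act l (Matrix.toEuclideanLin A (c j)),
      ?_, ?_, ?_⟩
    · calc _ ≤ C.card * Q ^ ⌊8 * (a l / s l) ^ 2 / τ l ^ 2⌋₊ :=
            Finset.card_biUnion_le_card_mul _ _ _ fun c hc =>
              Finset.card_image_le.trans (hG c hc).1
        _ ≤ Q ^ (∑ m ∈ layersBefore l.castSucc, ⌊8 * (a m / s m) ^ 2 / τ m ^ 2⌋₊)
              * Q ^ ⌊8 * (a l / s l) ^ 2 / τ l ^ 2⌋₊ := Nat.mul_le_mul_right _ hC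
        _ = _ := by
            rw [layersBefore_succ, Finset.sum_insert (notMem_layersBefore l), ← pow_add, add_comm]
    · intro c' hc' j
      simp only [Finset.mem_biUnion, Finset.mem_image] at hc'
      obtain ⟨c, hc, A, hA, rfl⟩ := hc'
      rw [hbs]
      calc ‖act l (Matrix.toEuclideanLin A (c j))‖
          ≤ ρ l * ‖Matrix.toEuclideanLin A (c j)‖ := norm_act_le hρ h0 l _
        _ ≤ ρ l * (specNorm A * ‖c j‖) := by gcongr; exact norm_toEuclideanLin_le _ _
        _ ≤ ρ l * (s l * b) := by
            gcongr
            · exact (hs l).le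
            · exact ((hG c hc).2.1 A hA).1
            · exact hCn c hc j
        _ = ρ l * s l * b := by ring
    · intro A hA
      obtain ⟨c, hc, hcA⟩ := hCc A hA
      obtain ⟨A', hA', hAA'⟩ := (hG c hc).2.2 (A l) (hA l)
      refine ⟨fun j => act l (Matrix.toEuclideanLin A' (c j)), ?_, fun j => ?_⟩
      · exact Finset.mem_biUnion.2 ⟨c, hc, Finset.mem_image_of_mem _ hA'⟩
      rw [hbs, hτs, layerOutput_succ]
      set y := layerOutput act A (x j) l.castSucc
      have h1 : ‖Matrix.toEuclideanLin (A l) y - Matrix.toEuclideanLin (A l) (c j)‖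
          ≤ s l * (b * ∑ m ∈ layersBefore l.castSucc, τ m) := by
        rw [← map_sub]
        calc _ ≤ specNorm (A l) * ‖y - c j‖ := norm_toEuclideanLin_le _ _
          _ ≤ _ := by
            gcongr
            · exact (hs l).le
            · exact (hA l).1
            · exact hcA j
      calc ‖act l (Matrix.toEuclideanLin (A l) y) - act l (Matrix.toEuclideanLin A' (c j))‖
          ≤ ρ l * ‖Matrix.toEuclideanLin (A l) y - Matrix.toEuclideanLin A' (c j)‖ := by
            simpa [dist_eq_norm] using (hρ l).dist_le_mul (Matrix.toEuclideanLin (A l) y)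
              (Matrix.toEuclideanLin A' (c j))
        _ ≤ ρ l * (s l * (b * ∑ m ∈ layersBefore l.castSucc, τ m) + s l * b * τ l) := by
            gcongr
            exact (norm_sub_le_norm_sub_add_norm_sub _ _ _).trans (add_le_add h1 (hAA' j))
        _ = _ := by ring

theorem maxWidth_ge (l : Fin L) : d l.succ ≤ maxWidth d :=
  Finset.le_sup (f := fun l : Fin L => d l.succ) (Finset.mem_univ l)

/-- The sum `∑ (a_l / s_l)^(2/3)`, whose power `3/2` enters the complexity of the class. -/
noncomputable def ratioSum (a s : Fin L → ℝ) : ℝ :=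
  ∑ l, a l ^ (2 / 3 : ℝ) / s l ^ (2 / 3 : ℝ)

theorem ratioSum_pos (hL : 1 ≤ L) {a s : Fin L → ℝ} (ha : ∀ l, 0 < a l) (hs : ∀ l, 0 < s l) :
    0 < ratioSum a s := by
  have : Nonempty (Fin L) := ⟨⟨0, hL⟩⟩
  exact Finset.sum_pos (fun l _ => div_pos (Real.rpow_pos_of_pos (ha l) _)
    (Real.rpow_pos_of_pos (hs l) _)) Finset.univ_nonempty

theorem rpow_two_thirds_pow_three {x : ℝ} (hx : 0 ≤ x) : (x ^ (2 / 3 : ℝ)) ^ 3 = x ^ 2 := by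
  rw [← Real.rpow_natCast, ← Real.rpow_mul hx, ← Real.rpow_natCast]; norm_num

/-- Covering of the network class on finitely many inputs. The accuracy `t` is distributed over
the layers in proportion to `(a_l / s_l)^(2/3)`, which minimizes the total length of the codes. -/
theorem exists_network_cover {κ : Type*} [Fintype κ] (hL : 1 ≤ L) (M : Weights d) {a s : Fin L → ℝ}
    {ρ : Fin L → NNReal} (hρ : ∀ l, LipschitzWith (ρ l) (act l)) (h0 : ∀ l, act l 0 = 0)
    (ha : ∀ l, 0 < a l) (hs : ∀ l, 0 < s l) {B : ℝ} (hB : 0 ≤ B)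
    (x : κ → Vec (d 0)) (hx : ∀ j, ‖x j‖ ≤ B) {t : ℝ} (ht : 0 < t) :
    ∃ (T : ℕ) (C : Finset (κ → Vec (d (Fin.last L)))),
      (T : ℝ) ≤ 8 * ratioSum a s ^ 3 / t ^ 2 ∧
      C.card ≤ (maxWidth d * (2 * Fintype.card κ + 1) + 1) ^ T ∧
      ∀ A ∈ weightSpace M a s, ∃ c ∈ C, ∀ j, ‖network act A (x j) - c j‖
        ≤ (B * ∏ l, (ρ l : ℝ) * s l) * t := by
  set r : Fin L → ℝ := fun l => a l ^ (2 / 3 : ℝ) / s l ^ (2 / 3 : ℝ) with hr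
  have hr0 : ∀ l, 0 < r l := fun l => div_pos (Real.rpow_pos_of_pos (ha l) _)
    (Real.rpow_pos_of_pos (hs l) _)
  have hr3 : ∀ l, (a l / s l) ^ 2 = r l ^ 3 := fun l => by
    rw [hr]
    simp only
    rw [div_pow, div_pow, rpow_two_thirds_pow_three (ha l).le, rpow_two_thirds_pow_three (hs l).le]
  have hS := ratioSum_pos hL ha hs
  set S := ratioSum a s with hSdef
  have hSr : S = ∑ l, r l := rfl
  obtain ⟨C, h1, -, h3⟩ := exists_layerOutput_cover M hρ h0 ha hs hB x hx
    (fun l => t * r l / S) (fun l => by have := hr0 l; positivity)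
    (Q := maxWidth d * (2 * Fintype.card κ + 1) + 1)
    (fun l => by gcongr; exact maxWidth_ge l) (Fin.last L)
  refine ⟨_, C, ?_, h1, ?_⟩
  · rw [layersBefore_last]
    push_cast
    calc ∑ l, ((⌊8 * (a l / s l) ^ 2 / (t * r l / S) ^ 2⌋₊ : ℕ) : ℝ)
        ≤ ∑ l, 8 * S ^ 2 / t ^ 2 * r l := Finset.sum_le_sum fun l _ => by
          have := hr0 l
          refine (Nat.floor_le (by positivity)).trans (le_of_eq ?_)
          rw [hr3]; field_simp
      _ = 8 * S ^ 3 / t ^ 2 := by rw [← Finset.mul_sum, ← hSr]; ring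
  · intro A hA
    obtain ⟨c, hc, h⟩ := h3 A hA
    refine ⟨c, hc, fun j => (h j).trans (le_of_eq ?_)⟩
    rw [layersBefore_last, ← Finset.sum_div, ← Finset.mul_sum, ← hSr]
    field_simp

end network

/-! ### Averages over signs and chaining -/

section signs
variable {n : ℕ}

/-- The sign `±1` of a truth value. -/
def boolSign (b : Bool) : ℝ := if b then 1 else -1

theorem boolSign_not (b : Bool) : boolSign (!b) = -boolSign b := by cases b <;> simp [boolSign]

theorem abs_boolSign (b : Bool) : |boolSign b| = 1 := by cases b <;> simp [boolSign]

/-- The signed sum `∑ i, ± v i`. -/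
noncomputable def signSum (σ : Fin n → Bool) (v : Fin n → ℝ) : ℝ := ∑ i, boolSign (σ i) * v i

/-- The average over all choices of signs. -/
noncomputable def signAvg (F : (Fin n → Bool) → ℝ) : ℝ := (∑ σ, F σ) / 2 ^ n

theorem signAvg_mono {F G : (Fin n → Bool) → ℝ} (h : ∀ σ, F σ ≤ G σ) : signAvg F ≤ signAvg G := by
  unfold signAvg; gcongr with σ; exact h σ

theorem signAvg_add (F G : (Fin n → Bool) → ℝ) :
    signAvg (fun σ => F σ + G σ) = signAvg F + signAvg G := by
  simp [signAvg, Finset.sum_add_distrib, add_div]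

theorem signAvg_const (c : ℝ) : signAvg (fun _ : Fin n → Bool => c) = c := by
  simp [signAvg]

theorem signAvg_sum {ι : Type*} (s : Finset ι) (F : ι → (Fin n → Bool) → ℝ) :
    signAvg (fun σ => ∑ j ∈ s, F j σ) = ∑ j ∈ s, signAvg (F j) := by
  simp only [signAvg]
  rw [Finset.sum_comm, Finset.sum_div]

theorem signAvg_not (F : (Fin n → Bool) → ℝ) :
    signAvg (fun σ => F fun i => !σ i) = signAvg F := by
  unfold signAvg
  congr 1
  exact Equiv.sum_comp (Equiv.arrowCongr (Equiv.refl (Fin n)) Equiv.boolNot) F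

theorem signSum_not (σ : Fin n → Bool) (v : Fin n → ℝ) :
    signSum (fun i => !σ i) v = -signSum σ v := by
  simp [signSum, boolSign_not]

theorem signAvg_signSum (v : Fin n → ℝ) : signAvg (fun σ => signSum σ v) = 0 := by
  have h := signAvg_not fun σ => signSum σ v
  simp only [signSum_not] at h
  have h2 : signAvg (fun σ => -signSum σ v) = -signAvg fun σ => signSum σ v := by
    simp [signAvg, neg_div]
  linarith

theorem signAvg_exp_le (v : Fin n → ℝ) :
    signAvg (fun σ => Real.exp (signSum σ v)) ≤ Real.exp ((∑ i, v i ^ 2) / 2) := by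
  have h : signAvg (fun σ => Real.exp (signSum σ v)) = ∏ i, Real.cosh (v i) := by
    simp only [signAvg, signSum, Real.exp_sum]
    rw [← Fintype.prod_sum fun i (b : Bool) => Real.exp (boolSign b * v i)]
    simp only [Fintype.sum_bool, boolSign, if_true, Bool.false_eq_true, if_false, one_mul,
      neg_mul, Real.cosh_eq, Finset.prod_div_distrib, Finset.prod_const, Finset.card_univ,
      Fintype.card_fin]
  rw [h, Finset.sum_div, Real.exp_sum]
  exact Finset.prod_le_prod (fun i _ => (Real.cosh_pos _).le) fun i _ => Real.cosh_le_exp_half_sq _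

theorem exp_signAvg_le (F : (Fin n → Bool) → ℝ) :
    Real.exp (signAvg F) ≤ signAvg fun σ => Real.exp (F σ) := by
  have h := convexOn_exp.map_sum_le (t := (Finset.univ : Finset (Fin n → Bool)))
    (w := fun _ => ((2 : ℝ) ^ n)⁻¹) (p := F) (fun _ _ => by positivity) (by simp)
    (fun _ _ => Set.mem_univ _)
  simpa [signAvg, ← Finset.mul_sum, div_eq_inv_mul] using h

/-- Massart's lemma. The function `F` is only assumed to be dominated, for each choice of signs, by
the signed sum of some vector of the finite set `V`. -/
theorem signAvg_le_of_card_le {F : (Fin n → Bool) → ℝ} {D ℓ : ℝ} (hD : 0 ≤ D) (hℓ : 0 < ℓ)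
    (V : Finset (Fin n → ℝ)) (hV : (V.card : ℝ) ≤ Real.exp ℓ) (hVD : ∀ v ∈ V, ∀ i, |v i| ≤ D)
    (hF : ∀ σ, ∃ v ∈ V, F σ ≤ signSum σ v) :
    signAvg F ≤ D * √n * √(2 * ℓ) := by
  have hmain : ∀ lam : ℝ, 0 < lam → lam * signAvg F ≤ ℓ + lam ^ 2 * (n * D ^ 2) / 2 := by
    intro lam hlam
    have h1 : Real.exp (lam * signAvg F) ≤ Real.exp (ℓ + lam ^ 2 * (n * D ^ 2) / 2) := by
      calc Real.exp (lam * signAvg F) = Real.exp (signAvg fun σ => lam * F σ) := by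
            simp [signAvg, ← Finset.mul_sum, mul_div_assoc]
        _ ≤ signAvg fun σ => Real.exp (lam * F σ) := exp_signAvg_le _
        _ ≤ signAvg fun σ => ∑ v ∈ V, Real.exp (signSum σ fun i => lam * v i) := by
            refine signAvg_mono fun σ => ?_
            obtain ⟨v, hv, h⟩ := hF σ
            refine le_trans ?_ (Finset.single_le_sum
              (f := fun v => Real.exp (signSum σ fun i => lam * v i))
              (fun _ _ => (Real.exp_pos _).le) hv)
            refine Real.exp_le_exp.2 ?_
            have : signSum σ (fun i => lam * v i) = lam * signSum σ v := by
              simp only [signSum, Finset.mul_sum]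
              exact Finset.sum_congr rfl fun i _ => by ring
            rw [this]; gcongr
        _ = ∑ v ∈ V, signAvg fun σ => Real.exp (signSum σ fun i => lam * v i) := signAvg_sum _ _
        _ ≤ ∑ v ∈ V, Real.exp (lam ^ 2 * (n * D ^ 2) / 2) := by
            refine Finset.sum_le_sum fun v hv => (signAvg_exp_le _).trans ?_
            refine Real.exp_le_exp.2 ?_
            gcongr
            calc ∑ i, (lam * v i) ^ 2 ≤ ∑ _i : Fin n, lam ^ 2 * D ^ 2 := by
                  refine Finset.sum_le_sum fun i _ => ?_
                  rw [mul_pow]; gcongr ?_ * ?_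
                  exact sq_le_sq' (abs_le.1 (hVD v hv i)).1 (abs_le.1 (hVD v hv i)).2
              _ = lam ^ 2 * (n * D ^ 2) := by simp; ring
        _ = V.card * Real.exp (lam ^ 2 * (n * D ^ 2) / 2) := by simp
        _ ≤ Real.exp ℓ * Real.exp (lam ^ 2 * (n * D ^ 2) / 2) := by gcongr
        _ = _ := by rw [Real.exp_add]
    exact Real.exp_le_exp.1 h1
  rcases (by positivity : 0 ≤ D * √n).eq_or_lt with h0 | hpos
  · -- the bound is `0`: let the parameter of the exponential moment tend to infinity
    have hz : (n : ℝ) * D ^ 2 = 0 := by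
      have : (D * √n) ^ 2 = 0 := by rw [← h0]; simp
      rw [mul_pow, Real.sq_sqrt (Nat.cast_nonneg n)] at this
      linarith
    rw [← h0, zero_mul]
    by_contra! hneg
    have := hmain (2 * ℓ / signAvg F) (by positivity)
    rw [hz, div_mul_cancel₀ _ hneg.ne'] at this
    linarith
  · -- the optimal parameter is `√(2ℓ) / (D √n)`
    have h := hmain (√(2 * ℓ) / (D * √n)) (by positivity)
    have h2 : (√(2 * ℓ) / (D * √n)) ^ 2 * (n * D ^ 2) = 2 * ℓ := by
      have hn : (n : ℝ) = √n ^ 2 := (Real.sq_sqrt (Nat.cast_nonneg n)).symm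
      have : (n : ℝ) * D ^ 2 = (D * √n) ^ 2 := by rw [mul_pow, ← hn]; ring
      rw [this, div_pow, div_mul_cancel₀ _ (by positivity), Real.sq_sqrt (by positivity)]
    rw [h2, div_mul_eq_mul_div, div_le_iff₀ hpos] at h
    have hs : √(2 * ℓ) ^ 2 = 2 * ℓ := Real.sq_sqrt (by positivity)
    have hspos : 0 < √(2 * ℓ) := by positivity
    have : √(2 * ℓ) * signAvg F ≤ √(2 * ℓ) * (D * √n * √(2 * ℓ)) := by nlinarith
    exact le_of_mul_le_mul_left this hspos

theorem signSum_sub (σ : Fin n → Bool) (v w : Fin n → ℝ) :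
    signSum σ (v - w) = signSum σ v - signSum σ w := by
  simp [signSum, mul_sub, Finset.sum_sub_distrib]

theorem signSum_le (σ : Fin n → Bool) {v : Fin n → ℝ} {D : ℝ} (h : ∀ i, |v i| ≤ D) :
    signSum σ v ≤ n * D := by
  calc signSum σ v ≤ ∑ _i : Fin n, D := by
        refine Finset.sum_le_sum fun i _ => (le_abs_self _).trans ?_
        rw [abs_mul, abs_boolSign, one_mul]; exact h i
    _ = n * D := by simp

/-- The discrete form of Dudley's entropy bound for a finite nonempty family `v` of vectors. The
map `c j` is a partition of the index set into pieces of diameter `E / 2 ^ j`; the first partition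
has a single piece. -/
theorem signAvg_sup_le {ι : Type*} [Fintype ι] [Nonempty ι] (v : ι → Fin n → ℝ) {E ℓ : ℝ}
    (hE : 0 ≤ E) (hℓ : 0 < ℓ) {γ : ℕ → Type*} (c : ∀ j, ι → γ j)
    (hc : ∀ j a b, c j a = c j b → ∀ i, |v a i - v b i| ≤ E / 2 ^ j)
    (hc0 : ∀ a b, c 0 a = c 0 b) (K : ∀ j, Finset (γ j)) (hcK : ∀ j a, c j a ∈ K j)
    (hK : ∀ j, ((K j).card : ℝ) ≤ Real.exp (4 ^ j / 2 * ℓ)) (J : ℕ) :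
    signAvg (fun σ => Finset.univ.sup' Finset.univ_nonempty fun a => signSum σ (v a))
      ≤ n * (E / 2 ^ J) + J * (3 * E * √n * √(2 * ℓ)) := by
  classical
  -- `π j a` is the representative of the piece of `a`
  have hπ : ∀ j, ∃ r : γ j → ι, ∀ a, c j (r (c j a)) = c j a := fun j => by
    refine ⟨fun g => if h : ∃ a, c j a = g then h.choose else Classical.arbitrary ι, fun a => ?_⟩
    have h : ∃ b, c j b = c j a := ⟨a, rfl⟩
    simp only [dif_pos h]; exact h.choose_spec
  choose r hr using hπ
  set π : ∀ j, ι → ι := fun j a => r j (c j a) with hπdef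
  have hπ_close : ∀ j a i, |v a i - v (π j a) i| ≤ E / 2 ^ j := fun j a i =>
    hc j a (π j a) (hr j a).symm i
  set a₀ : ι := π 0 (Classical.arbitrary ι) with ha₀
  have hπ0 : ∀ a, π 0 a = a₀ := fun a => by
    simp only [hπdef, ha₀]; rw [hc0 a (Classical.arbitrary ι)]
  set link : ℕ → (Fin n → Bool) → ℝ := fun j σ => Finset.univ.sup' Finset.univ_nonempty
    fun a => signSum σ (v (π (j + 1) a) - v (π j a)) with hlink
  have hchain : ∀ σ, (Finset.univ.sup' Finset.univ_nonempty fun a => signSum σ (v a))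
      ≤ n * (E / 2 ^ J) + (∑ j ∈ Finset.range J, link j σ + signSum σ (v a₀)) := fun σ => by
    refine Finset.sup'_le _ _ fun a _ => ?_
    have htel : signSum σ (v a) = signSum σ (v a - v (π J a))
        + (∑ j ∈ Finset.range J, signSum σ (v (π (j + 1) a) - v (π j a)) + signSum σ (v a₀)) := by
      simp only [signSum_sub]
      rw [Finset.sum_range_sub fun j => signSum σ (v (π j a)), hπ0]
      ring
    rw [htel]
    gcongr with j hj
    · exact signSum_le σ fun i => hπ_close J a i
    · exact Finset.le_sup' (fun a => signSum σ (v (π (j + 1) a) - v (π j a))) (Finset.mem_univ a)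
  have hlink_le : ∀ j, signAvg (link j) ≤ 3 * E * √n * √(2 * ℓ) := fun j => by
    have hpow : (0 : ℝ) < 2 ^ j := by positivity
    set V : Finset (Fin n → ℝ) := (K (j + 1) ×ˢ K j).image
      fun g => v (r (j + 1) g.1) - v (r j g.2) with hV
    set V' := V.filter fun w => ∀ i, |w i| ≤ 3 / 2 * (E / 2 ^ j) with hV'
    have hmass := signAvg_le_of_card_le (F := link j) (D := 3 / 2 * (E / 2 ^ j))
      (ℓ := 4 ^ (j + 1) / 2 * ℓ + 4 ^ j / 2 * ℓ) (by positivity) (by positivity) V' ?_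
      (fun w hw => (Finset.mem_filter.1 hw).2) ?_
    · refine hmass.trans ?_
      have h4 : √(2 * (4 ^ (j + 1) / 2 * ℓ + 4 ^ j / 2 * ℓ)) ≤ 2 * 2 ^ j * √(2 * ℓ) := by
        rw [Real.sqrt_le_left (by positivity), mul_pow, mul_pow, Real.sq_sqrt (by positivity),
          ← pow_mul, mul_comm j 2, pow_mul]
        have : (0 : ℝ) < 4 ^ j * ℓ := by positivity
        rw [pow_succ]; norm_num; nlinarith
      calc 3 / 2 * (E / 2 ^ j) * √n * √(2 * (4 ^ (j + 1) / 2 * ℓ + 4 ^ j / 2 * ℓ))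
          ≤ 3 / 2 * (E / 2 ^ j) * √n * (2 * 2 ^ j * √(2 * ℓ)) := by gcongr
        _ = 3 * E * √n * √(2 * ℓ) := by field_simp
    · have h1 : V'.card ≤ (K (j + 1)).card * (K j).card :=
        (Finset.card_filter_le _ _).trans (Finset.card_image_le.trans (Finset.card_product _ _).le)
      calc (V'.card : ℝ) ≤ (K (j + 1)).card * (K j).card := by exact_mod_cast h1
        _ ≤ Real.exp (4 ^ (j + 1) / 2 * ℓ) * Real.exp (4 ^ j / 2 * ℓ) := by
            gcongr
            · exact hK _
            · exact hK _
        _ = _ := by rw [Real.exp_add]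
    · intro σ
      obtain ⟨a, -, ha⟩ := Finset.exists_mem_eq_sup' (Finset.univ_nonempty (α := ι))
        fun a => signSum σ (v (π (j + 1) a) - v (π j a))
      refine ⟨_, Finset.mem_filter.2 ⟨Finset.mem_image.2 ⟨(c (j + 1) a, c j a),
        Finset.mem_product.2 ⟨hcK _ _, hcK _ _⟩, rfl⟩, fun i => ?_⟩, ha.le⟩
      calc |v (π (j + 1) a) i - v (π j a) i|
          = |(v a i - v (π j a) i) - (v a i - v (π (j + 1) a) i)| := by congr 1; ring
        _ ≤ |v a i - v (π j a) i| + |v a i - v (π (j + 1) a) i| := abs_sub _ _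
        _ ≤ E / 2 ^ j + E / 2 ^ (j + 1) := add_le_add (hπ_close _ _ _) (hπ_close _ _ _)
        _ = 3 / 2 * (E / 2 ^ j) := by rw [pow_succ]; field_simp; ring
  calc _ ≤ signAvg fun σ => n * (E / 2 ^ J) + (∑ j ∈ Finset.range J, link j σ
        + signSum σ (v a₀)) := signAvg_mono hchain
    _ = n * (E / 2 ^ J) + ∑ j ∈ Finset.range J, signAvg (link j) := by
        rw [signAvg_add, signAvg_const, signAvg_add, signAvg_sum, signAvg_signSum, add_zero]
    _ ≤ n * (E / 2 ^ J) + ∑ _j ∈ Finset.range J, 3 * E * √n * √(2 * ℓ) := by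
        gcongr with j hj; exact hlink_le j
    _ = _ := by simp

end signs

/-! ### The bounded differences inequality -/

section concentration
variable {X : Type*} [MeasurableSpace X]

theorem integrable_of_abs_le {μ : Measure X} [IsFiniteMeasure μ] {f : X → ℝ} (hf : Measurable f)
    {C : ℝ} (hC : ∀ x, |f x| ≤ C) : Integrable f μ :=
  Integrable.of_bound hf.aestronglyMeasurable C (Filter.Eventually.of_forall hC)

/-- Hoeffding's lemma for a function whose values differ by at most `c`. -/
theorem integral_exp_le_of_sub_le (μ : Measure X) [IsProbabilityMeasure μ] {f : X → ℝ}
    (hf : Measurable f) {c : ℝ} (hd : ∀ x y, f x - f y ≤ c) (lam : ℝ) :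
    ∫ x, Real.exp (lam * f x) ∂μ ≤ Real.exp (lam * ∫ x, f x ∂μ + lam ^ 2 * c ^ 2 / 8) := by
  have : Nonempty X := μ.nonempty_of_neZero
  have hbdd : BddBelow (Set.range f) :=
    ⟨f (Classical.arbitrary X) - c, by rintro _ ⟨y, rfl⟩; linarith [hd (Classical.arbitrary X) y]⟩
  have hmem : ∀ x, f x ∈ Set.Icc (⨅ y, f y) ((⨅ y, f y) + c) := fun x => by
    refine ⟨ciInf_le hbdd x, ?_⟩
    have : f x - c ≤ ⨅ y, f y := le_ciInf fun y => by linarith [hd x y]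
    linarith
  have h := (ProbabilityTheory.hasSubgaussianMGF_of_mem_Icc (μ := μ) hf.aemeasurable
    (Filter.Eventually.of_forall hmem)).mgf_le lam
  have hc' : (((‖(⨅ y, f y) + c - ⨅ y, f y‖₊ / 2) ^ 2 : NNReal) : ℝ) * lam ^ 2 / 2
      = lam ^ 2 * c ^ 2 / 8 := by
    push_cast
    rw [add_sub_cancel_left, Real.norm_eq_abs, div_pow, sq_abs]; ring
  rw [hc', ProbabilityTheory.mgf] at h
  calc ∫ x, Real.exp (lam * f x) ∂μ
      = Real.exp (lam * ∫ x, f x ∂μ) * ∫ x, Real.exp (lam * (f x - ∫ x, f x ∂μ)) ∂μ := by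
        rw [← integral_const_mul]
        refine integral_congr_ae (Filter.Eventually.of_forall fun x => ?_)
        simp only
        rw [← Real.exp_add]; ring_nf
    _ ≤ Real.exp (lam * ∫ x, f x ∂μ) * Real.exp (lam ^ 2 * c ^ 2 / 8) := by gcongr
    _ = _ := by rw [Real.exp_add]

theorem integral_pi_succ (μ : Measure X) [IsProbabilityMeasure μ] {n : ℕ}
    {F : (Fin (n + 1) → X) → ℝ} (hF : Measurable F) {C : ℝ} (hC : ∀ x, |F x| ≤ C) :
    ∫ x, F x ∂(Measure.pi fun _ : Fin (n + 1) => μ)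
      = ∫ y, ∫ x₀, F (Fin.cons x₀ y) ∂μ ∂(Measure.pi fun _ : Fin n => μ) := by
  have hmp := (measurePreserving_piFinSuccAbove (fun _ : Fin (n + 1) => μ) 0).symm
  have hsymm : ∀ p : X × (Fin n → X),
      (MeasurableEquiv.piFinSuccAbove (fun _ : Fin (n + 1) => X) 0).symm p
        = Fin.cons p.1 p.2 := fun p => by
    ext i; simp [MeasurableEquiv.piFinSuccAbove]
  rw [← hmp.integral_comp', integral_prod_symm]
  · simp only [hsymm]
  · exact integrable_of_abs_le (hF.comp (MeasurableEquiv.measurable _)) fun p => hC _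

theorem measurable_cons {n : ℕ} :
    Measurable fun p : X × (Fin n → X) => (Fin.cons p.1 p.2 : Fin (n + 1) → X) := by
  refine measurable_pi_lambda _ fun i => ?_
  refine Fin.cases ?_ (fun j => ?_) i
  · simpa using measurable_fst
  · simpa [Function.comp_def] using (measurable_pi_apply j).comp measurable_snd

/-- The exponential moments behind the bounded differences inequality: integrating out one
coordinate at a time preserves the bounded differences, and costs a factor given by Hoeffding's
lemma. -/
theorem integral_exp_le_of_bounded_differences (μ : Measure X) [IsProbabilityMeasure μ]
    {c C : ℝ} (lam : ℝ) (n : ℕ) (f : (Fin n → X) → ℝ) (hf : Measurable f)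
    (hC : ∀ x, |f x| ≤ C) (hd : ∀ x i y, f (Function.update x i y) ≤ f x + c) :
    ∫ x, Real.exp (lam * f x) ∂(Measure.pi fun _ : Fin n => μ)
      ≤ Real.exp (lam * ∫ x, f x ∂(Measure.pi fun _ : Fin n => μ)
          + n * (lam ^ 2 * c ^ 2 / 8)) := by
  induction n with
  | zero =>
    rw [Measure.pi_of_empty, integral_dirac, integral_dirac]
    simp
  | succ n ih =>
    have hexpm : Measurable fun x => Real.exp (lam * f x) :=
      Real.measurable_exp.comp (hf.const_mul lam)
    have hexpC : ∀ x, |Real.exp (lam * f x)| ≤ Real.exp (|lam| * C) := fun x => by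
      rw [abs_of_pos (Real.exp_pos _)]
      refine Real.exp_le_exp.2 ((le_abs_self _).trans ?_)
      rw [abs_mul]; gcongr; exact hC x
    have hfc : Measurable fun p : X × (Fin n → X) => f (Fin.cons p.1 p.2) :=
      hf.comp measurable_cons
    set h : (Fin n → X) → ℝ := fun y => ∫ x₀, f (Fin.cons x₀ y) ∂μ with hh
    have hslice : ∀ y : Fin n → X, Measurable fun x₀ => f (Fin.cons x₀ y) := fun y =>
      hfc.comp (measurable_id.prodMk measurable_const)
    have hint : ∀ y : Fin n → X, Integrable (fun x₀ => f (Fin.cons x₀ y)) μ := fun y =>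
      integrable_of_abs_le (hslice y) fun x₀ => hC _
    have hhm : Measurable h :=
      (StronglyMeasurable.integral_prod_left (f := fun x₀ y => f (Fin.cons x₀ y))
        hfc.stronglyMeasurable).measurable
    have hhC : ∀ y, |h y| ≤ C := fun y => by
      have := norm_integral_le_of_norm_le_const (μ := μ)
        (f := fun x₀ => f (Fin.cons x₀ y)) (Filter.Eventually.of_forall fun x₀ => hC _)
      simpa using this
    have hhd : ∀ y i z, h (Function.update y i z) ≤ h y + c := fun y i z => by
      calc h (Function.update y i z) ≤ ∫ x₀, (f (Fin.cons x₀ y) + c) ∂μ := by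
            refine integral_mono (hint _) ((hint y).add (integrable_const c)) fun x₀ => ?_
            simp only
            rw [Fin.cons_update]
            exact hd _ _ _
        _ = h y + c := by rw [integral_add (hint y) (integrable_const c)]; simp [hh]
    have hin : ∀ y, ∫ x₀, Real.exp (lam * f (Fin.cons x₀ y)) ∂μ
        ≤ Real.exp (lam ^ 2 * c ^ 2 / 8) * Real.exp (lam * h y) := fun y => by
      refine (integral_exp_le_of_sub_le μ (hslice y) (c := c) (fun x₀ x₁ => ?_) lam).trans
        (le_of_eq ?_)
      · have := hd (Fin.cons x₁ y) 0 x₀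
        rw [Fin.update_cons_zero] at this
        linarith
      · rw [← Real.exp_add, add_comm]
    have hexph : Integrable (fun y => Real.exp (lam * h y)) (Measure.pi fun _ : Fin n => μ) := by
      refine integrable_of_abs_le (C := Real.exp (|lam| * C))
        (Real.measurable_exp.comp (hhm.const_mul lam)) fun y => ?_
      rw [abs_of_pos (Real.exp_pos _)]
      refine Real.exp_le_exp.2 ((le_abs_self _).trans ?_)
      rw [abs_mul]; gcongr; exact hhC y
    rw [integral_pi_succ μ hexpm hexpC, integral_pi_succ μ hf hC]
    calc ∫ y, ∫ x₀, Real.exp (lam * f (Fin.cons x₀ y)) ∂μ ∂(Measure.pi fun _ : Fin n => μ)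
        ≤ ∫ y, Real.exp (lam ^ 2 * c ^ 2 / 8) * Real.exp (lam * h y)
            ∂(Measure.pi fun _ : Fin n => μ) := by
          refine integral_mono_of_nonneg (Filter.Eventually.of_forall fun y =>
            integral_nonneg fun _ => (Real.exp_pos _).le) (hexph.const_mul _)
            (Filter.Eventually.of_forall hin)
      _ = Real.exp (lam ^ 2 * c ^ 2 / 8)
            * ∫ y, Real.exp (lam * h y) ∂(Measure.pi fun _ : Fin n => μ) := integral_const_mul _ _
      _ ≤ Real.exp (lam ^ 2 * c ^ 2 / 8)
            * Real.exp (lam * ∫ y, h y ∂(Measure.pi fun _ : Fin n => μ)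
              + n * (lam ^ 2 * c ^ 2 / 8)) := by
          gcongr; exact ih h hhm hhC hhd
      _ = _ := by rw [← Real.exp_add, hh]; push_cast; ring_nf

/-- McDiarmid's inequality for differences `1 / n`, in the form of a confidence bound. -/
theorem measure_bounded_differences_le (μ : Measure X) [IsProbabilityMeasure μ] {n : ℕ}
    (hn : 1 ≤ n) {C : ℝ} {f : (Fin n → X) → ℝ} (hf : Measurable f) (hC : ∀ x, |f x| ≤ C)
    (hd : ∀ x i y, f (Function.update x i y) ≤ f x + 1 / n) {δ : ℝ} (hδ : 0 < δ) (hδ1 : δ < 1) :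
    (Measure.pi fun _ : Fin n => μ)
      {x | ∫ y, f y ∂(Measure.pi fun _ : Fin n => μ) + √(Real.log (1 / δ) / (2 * n)) ≤ f x}
      ≤ ENNReal.ofReal δ := by
  set P := Measure.pi fun _ : Fin n => μ with hP
  have hn0 : (0 : ℝ) < n := by exact_mod_cast hn
  have hlog : 0 < Real.log (1 / δ) := Real.log_pos (by rw [lt_div_iff₀ hδ]; linarith)
  set t : ℝ := √(Real.log (1 / δ) / (2 * n)) with ht
  have ht2 : t ^ 2 = Real.log (1 / δ) / (2 * n) := Real.sq_sqrt (by positivity)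
  set lam : ℝ := 4 * n * t with hlam
  have hlam0 : 0 ≤ lam := by positivity
  have hexp : Integrable (fun x => Real.exp (lam * f x)) P := by
    refine integrable_of_abs_le (C := Real.exp (|lam| * C))
      (Real.measurable_exp.comp (hf.const_mul lam)) fun y => ?_
    rw [abs_of_pos (Real.exp_pos _)]
    refine Real.exp_le_exp.2 ((le_abs_self _).trans ?_)
    rw [abs_mul]; gcongr; exact hC y
  have h1 := ProbabilityTheory.measure_ge_le_exp_mul_mgf (X := f) (μ := P)
    (∫ y, f y ∂P + t) hlam0 hexp
  have h2 := integral_exp_le_of_bounded_differences μ (c := 1 / (n : ℝ)) lam n f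
    hf hC hd
  have h3 : P.real {x | ∫ y, f y ∂P + t ≤ f x} ≤ δ := by
    refine h1.trans ?_
    calc Real.exp (-lam * (∫ y, f y ∂P + t)) * ProbabilityTheory.mgf f P lam
        ≤ Real.exp (-lam * (∫ y, f y ∂P + t))
            * Real.exp (lam * ∫ y, f y ∂P + n * (lam ^ 2 * (1 / (n : ℝ)) ^ 2 / 8)) := by
          gcongr; exact h2
      _ = Real.exp (-Real.log (1 / δ)) := by
          rw [← Real.exp_add]
          congr 1
          have : (n : ℝ) * (lam ^ 2 * (1 / (n : ℝ)) ^ 2 / 8) = 2 * n * t ^ 2 := by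
            rw [hlam]; field_simp; ring
          rw [this]
          have h5 : lam * t = 4 * n * t ^ 2 := by rw [hlam]; ring
          have h6 : 2 * n * t ^ 2 = Real.log (1 / δ) := by rw [ht2]; field_simp
          linarith
      _ = δ := by rw [one_div, Real.log_inv, neg_neg, Real.exp_log hδ]
  rw [← ENNReal.ofReal_toReal (measure_ne_top P _)]
  exact ENNReal.ofReal_le_ofReal h3

end concentration

/-! ### Symmetrization -/

section symmetrization
variable {X : Type*} [MeasurableSpace X]

theorem integral_comp_measurePreserving {Y : Type*} [MeasurableSpace Y] {μ : Measure X}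
    {ν : Measure Y} {φ : X → Y} (hφ : MeasurePreserving φ μ ν) {F : Y → ℝ} (hF : Measurable F) :
    ∫ x, F (φ x) ∂μ = ∫ y, F y ∂ν := by
  rw [← hφ.map_eq, integral_map hφ.measurable.aemeasurable hF.aestronglyMeasurable]

theorem measurable_sup'_apply {ι : Type*} {s : Finset ι} (hs : s.Nonempty) {f : ι → X → ℝ}
    (hf : ∀ a ∈ s, Measurable (f a)) : Measurable fun x => s.sup' hs fun a => f a x := by
  have h : (fun x => s.sup' hs fun a => f a x) = s.sup' hs f :=
    funext fun x => (Finset.sup'_apply hs f x).symm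
  rw [h]
  exact Finset.measurable_sup' hs hf

theorem abs_sup'_le {ι : Type*} {s : Finset ι} (hs : s.Nonempty) {f : ι → ℝ} {C : ℝ}
    (h : ∀ a ∈ s, |f a| ≤ C) : |s.sup' hs f| ≤ C := by
  obtain ⟨a, ha, he⟩ := Finset.exists_mem_eq_sup' hs f
  rw [he]; exact h a ha

theorem abs_signSum_le {n : ℕ} (σ : Fin n → Bool) {v : Fin n → ℝ} {D : ℝ} (h : ∀ i, |v i| ≤ D) :
    |signSum σ v| ≤ n * D := by
  refine abs_le'.2 ⟨signSum_le σ h, ?_⟩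
  rw [← signSum_not]; exact signSum_le _ h

/-- The largest deviation of an empirical mean below its expectation, over a finite family. -/
noncomputable def maxDeviation {ι : Type*} [Fintype ι] [Nonempty ι] (μ : Measure X)
    (g : ι → X → ℝ) {n : ℕ} (S : Fin n → X) : ℝ :=
  Finset.univ.sup' Finset.univ_nonempty fun a => ∫ x, g a x ∂μ - (∑ j, g a (S j)) / n

variable {ι : Type*} [Fintype ι] [Nonempty ι]

theorem le_maxDeviation (μ : Measure X) (g : ι → X → ℝ) {n : ℕ} (S : Fin n → X) (a : ι) :
    ∫ x, g a x ∂μ - (∑ j, g a (S j)) / n ≤ maxDeviation μ g S :=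
  Finset.le_sup' (fun a => ∫ x, g a x ∂μ - (∑ j, g a (S j)) / n) (Finset.mem_univ a)

theorem measurable_maxDeviation {μ : Measure X} {g : ι → X → ℝ} (hg : ∀ a, Measurable (g a))
    (n : ℕ) : Measurable (maxDeviation μ g (n := n)) := by
  refine measurable_sup'_apply _ fun a _ => ?_
  refine measurable_const.sub (Measurable.div_const ?_ _)
  exact Finset.measurable_sum _ fun j _ => (hg a).comp (measurable_pi_apply j)

theorem measurable_sup_signSum {g : ι → X → ℝ} (hg : ∀ a, Measurable (g a)) {n : ℕ}
    (σ : Fin n → Bool) : Measurable fun S : Fin n → X =>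
      Finset.univ.sup' Finset.univ_nonempty fun a => signSum σ fun j => g a (S j) := by
  refine measurable_sup'_apply _ fun a _ => ?_
  exact Finset.measurable_sum _ fun j _ =>
    measurable_const.mul ((hg a).comp (measurable_pi_apply j))

theorem abs_maxDeviation_le {μ : Measure X} [IsProbabilityMeasure μ] {g : ι → X → ℝ}
    (hg1 : ∀ a x, |g a x| ≤ 1) {n : ℕ} (S : Fin n → X) : |maxDeviation μ g S| ≤ 2 := by
  refine abs_sup'_le _ fun a _ => ?_
  have h1 : |∫ x, g a x ∂μ| ≤ 1 := by
    have := norm_integral_le_of_norm_le_const (μ := μ) (f := g a)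
      (Filter.Eventually.of_forall fun x => hg1 a x)
    simpa using this
  have h2 : |(∑ j, g a (S j)) / n| ≤ 1 := by
    rw [abs_div, Nat.abs_cast]
    refine div_le_one_of_le₀ ?_ (Nat.cast_nonneg n)
    calc |∑ j, g a (S j)| ≤ ∑ j : Fin n, |g a (S j)| := Finset.abs_sum_le_sum_abs _ _
      _ ≤ ∑ _j : Fin n, (1 : ℝ) := Finset.sum_le_sum fun j _ => hg1 a _
      _ = n := by simp
  calc _ ≤ |∫ x, g a x ∂μ| + |(∑ j, g a (S j)) / n| := abs_sub _ _
    _ ≤ 2 := by linarith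

theorem maxDeviation_update_le {μ : Measure X} {g : ι → X → ℝ}
    (hg : ∀ a x, 0 ≤ g a x ∧ g a x ≤ 1) {n : ℕ} (S : Fin n → X) (i : Fin n) (y : X) :
    maxDeviation μ g (Function.update S i y) ≤ maxDeviation μ g S + 1 / n := by
  refine Finset.sup'_le _ _ fun a _ => ?_
  have h1 := le_maxDeviation μ g S a
  have h2 : ∑ j, g a (S j) - 1 ≤ ∑ j, g a (Function.update S i y j) := by
    rw [← Finset.add_sum_erase _ _ (Finset.mem_univ i),
      ← Finset.add_sum_erase _ (fun j => g a (Function.update S i y j)) (Finset.mem_univ i)]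
    have h3 : ∑ j ∈ Finset.univ.erase i, g a (Function.update S i y j)
        = ∑ j ∈ Finset.univ.erase i, g a (S j) :=
      Finset.sum_congr rfl fun j hj => by rw [Function.update_of_ne (Finset.ne_of_mem_erase hj)]
    rw [h3, Function.update_self]
    linarith [(hg a (S i)).2, (hg a y).1]
  have h4 : (∑ j, g a (S j)) / n - 1 / n ≤ (∑ j, g a (Function.update S i y j)) / n := by
    rw [← sub_div]; gcongr
  linarith

/-- Exchanging the two components of a pair when the truth value is `false`. -/
def condSwap {Y : Type*} (b : Bool) (p : Y × Y) : Y × Y := if b then p else p.swap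

theorem measurePreserving_condSwap (μ : Measure X) [IsProbabilityMeasure μ] (b : Bool) :
    MeasurePreserving (condSwap b) (μ.prod μ) (μ.prod μ) := by
  cases b
  · exact Measure.measurePreserving_swap
  · exact MeasurePreserving.id _

theorem sub_condSwap {Y : Type*} (b : Bool) (h : Y → ℝ) (p : Y × Y) :
    h (condSwap b p).2 - h (condSwap b p).1 = boolSign b * (h p.2 - h p.1) := by
  cases b <;> simp [condSwap, boolSign]

/-- Symmetrization. The expectation `∫ g a` is the mean over an independent second sample; as the
pairs of corresponding sample points are exchangeable, random signs may be inserted. -/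
theorem integral_maxDeviation_le (μ : Measure X) [IsProbabilityMeasure μ] {g : ι → X → ℝ}
    (hg : ∀ a, Measurable (g a)) (hg1 : ∀ a x, |g a x| ≤ 1) {n : ℕ} (hn : 1 ≤ n) {b : ℝ}
    (hb : ∀ᵐ S ∂(Measure.pi fun _ : Fin n => μ),
      signAvg (fun σ => Finset.univ.sup' Finset.univ_nonempty
        fun a => signSum σ fun j => g a (S j)) ≤ b) :
    ∫ S, maxDeviation μ g S ∂(Measure.pi fun _ : Fin n => μ) ≤ 2 / n * b := by
  set P := Measure.pi fun _ : Fin n => μ with hP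
  have hn0 : (0 : ℝ) < n := by exact_mod_cast hn
  set sup : (ι → ℝ) → ℝ := fun f => Finset.univ.sup' Finset.univ_nonempty f with hsup
  set H : (Fin n → X) × (Fin n → X) → ℝ :=
    fun p => sup fun a => ∑ j, (g a (p.2 j) - g a (p.1 j)) with hH
  have hcomp : ∀ a (j : Fin n), Measurable fun S : Fin n → X => g a (S j) := fun a j =>
    (hg a).comp (measurable_pi_apply j)
  have hHm : Measurable H := measurable_sup'_apply _ fun a _ =>
    Finset.measurable_sum _ fun j _ =>
      ((hcomp a j).comp measurable_snd).sub ((hcomp a j).comp measurable_fst)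
  have hHb : ∀ p, |H p| ≤ n * 2 := fun p => by
    refine abs_sup'_le _ fun a _ => ?_
    calc |∑ j, (g a (p.2 j) - g a (p.1 j))| ≤ ∑ j, |g a (p.2 j) - g a (p.1 j)| :=
          Finset.abs_sum_le_sum_abs _ _
      _ ≤ ∑ _j : Fin n, (2 : ℝ) := Finset.sum_le_sum fun j _ =>
          (abs_sub _ _).trans (by linarith [hg1 a (p.2 j), hg1 a (p.1 j)])
      _ = n * 2 := by simp
  have hHi : Integrable H (P.prod P) := integrable_of_abs_le hHm hHb
  -- comparison with an independent second sample
  have hghost : ∀ S, maxDeviation μ g S ≤ (∫ S', H (S, S') ∂P) / n := fun S => by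
    refine Finset.sup'_le _ _ fun a _ => ?_
    have hi : ∀ j : Fin n, Integrable (fun S' : Fin n → X => g a (S' j)) P := fun j =>
      integrable_of_abs_le (hcomp a j) fun S' => hg1 a _
    have h1 : ∫ S', ∑ j, (g a (S' j) - g a (S j)) ∂P
        = n * ∫ x, g a x ∂μ - ∑ j, g a (S j) := by
      have hsub : ∀ j : Fin n, Integrable (fun S' : Fin n → X => g a (S' j) - g a (S j)) P :=
        fun j => (hi j).sub (integrable_const _)
      rw [integral_finsetSum _ fun j _ => hsub j]
      have : ∀ j : Fin n, ∫ S', (g a (S' j) - g a (S j)) ∂P = ∫ x, g a x ∂μ - g a (S j) :=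
        fun j => by
        rw [integral_sub (hi j) (integrable_const _),
          integral_comp_measurePreserving (measurePreserving_eval (fun _ : Fin n => μ) j) (hg a)]
        simp
      simp [this]
    have h2 : ∫ S', ∑ j, (g a (S' j) - g a (S j)) ∂P ≤ ∫ S', H (S, S') ∂P := by
      refine integral_mono (integrable_finsetSum _ fun j _ => (hi j).sub (integrable_const _))
        (integrable_of_abs_le (hHm.comp (measurable_const.prodMk measurable_id)) fun S' => hHb _)
        fun S' => ?_
      exact Finset.le_sup' (fun a => ∑ j, (g a (S' j) - g a (S j))) (Finset.mem_univ a)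
    rw [le_div_iff₀ hn0, sub_mul, div_mul_cancel₀ _ hn0.ne']
    linarith
  have hstep1 : ∫ S, maxDeviation μ g S ∂P ≤ (∫ p, H p ∂(P.prod P)) / n := by
    rw [integral_prod _ hHi, ← integral_div]
    exact integral_mono (integrable_of_abs_le (measurable_maxDeviation hg n)
      (abs_maxDeviation_le hg1)) (hHi.integral_prod_left.div_const _) hghost
  -- the sample of pairs, and the insertion of signs
  set PP := Measure.pi fun _ : Fin n => μ.prod μ with hPP
  set H₂ : (Fin n → X × X) → ℝ := fun Z => H (fun j => (Z j).1, fun j => (Z j).2) with hH₂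
  have hunzip : Measurable fun Z : Fin n → X × X => ((fun j => (Z j).1, fun j => (Z j).2) :
      (Fin n → X) × (Fin n → X)) :=
    (measurable_pi_lambda _ fun j => measurable_fst.comp (measurable_pi_apply j)).prodMk
      (measurable_pi_lambda _ fun j => measurable_snd.comp (measurable_pi_apply j))
  have hpairs : ∫ p, H p ∂(P.prod P) = ∫ Z, H₂ Z ∂PP :=
    ((measurePreserving_arrowProdEquivProdArrow X X (Fin n) (fun _ => μ)
      (fun _ => μ)).integral_comp' H).symm
  set R : (Fin n → Bool) → (Fin n → X) → ℝ :=
    fun σ S => sup fun a => signSum σ fun j => g a (S j) with hR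
  have hRm : ∀ σ, Measurable (R σ) := fun σ => measurable_sup_signSum hg σ
  have hRb : ∀ σ S, |R σ S| ≤ n * 1 := fun σ S =>
    abs_sup'_le _ fun a _ => abs_signSum_le σ fun j => hg1 a _
  have hsign : ∀ σ : Fin n → Bool,
      ∫ Z, H₂ Z ∂PP ≤ ∫ S, R σ S ∂P + ∫ S, R (fun j => !σ j) S ∂P := fun σ => by
    have hswap : MeasurePreserving (fun (Z : Fin n → X × X) j => condSwap (σ j) (Z j)) PP PP :=
      measurePreserving_pi _ _ fun j => measurePreserving_condSwap μ (σ j)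
    have hfst : MeasurePreserving (fun (Z : Fin n → X × X) j => (Z j).1) PP P :=
      measurePreserving_pi _ _ fun j => measurePreserving_fst
    have hsnd : MeasurePreserving (fun (Z : Fin n → X × X) j => (Z j).2) PP P :=
      measurePreserving_pi _ _ fun j => measurePreserving_snd
    have hH₂m : Measurable H₂ := hHm.comp hunzip
    have hi₀ : Integrable (fun Z : Fin n → X × X => H₂ fun j => condSwap (σ j) (Z j)) PP :=
      integrable_of_abs_le (hH₂m.comp hswap.measurable) fun Z => hHb _
    have hi₁ : Integrable (fun Z : Fin n → X × X => R σ fun j => (Z j).2) PP :=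
      integrable_of_abs_le ((hRm σ).comp hsnd.measurable) fun Z => hRb _ _
    have hi₂ : Integrable (fun Z : Fin n → X × X => R (fun j => !σ j) fun j => (Z j).1) PP :=
      integrable_of_abs_le ((hRm _).comp hfst.measurable) fun Z => hRb _ _
    rw [← integral_comp_measurePreserving hswap hH₂m,
      ← integral_comp_measurePreserving hsnd (hRm σ),
      ← integral_comp_measurePreserving hfst (hRm _), ← integral_add hi₁ hi₂]
    refine integral_mono hi₀ (hi₁.add hi₂) fun Z => ?_
    refine Finset.sup'_le _ _ fun a _ => ?_
    have h1 : ∑ j, (g a (condSwap (σ j) (Z j)).2 - g a (condSwap (σ j) (Z j)).1)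
        = signSum σ (fun j => g a (Z j).2) + signSum (fun j => !σ j) fun j => g a (Z j).1 := by
      simp only [sub_condSwap, signSum, boolSign_not, ← Finset.sum_add_distrib]
      exact Finset.sum_congr rfl fun j _ => by ring
    simp only [h1]
    exact add_le_add
      (Finset.le_sup' (fun a => signSum σ fun j => g a (Z j).2) (Finset.mem_univ a))
      (Finset.le_sup' (fun a => signSum (fun j => !σ j) fun j => g a (Z j).1) (Finset.mem_univ a))
  have hRi : ∀ σ, Integrable (R σ) P := fun σ => integrable_of_abs_le (hRm σ) (hRb σ)
  have havg : signAvg (fun σ => ∫ S, R σ S ∂P) = ∫ S, signAvg (fun σ => R σ S) ∂P := by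
    simp only [signAvg]
    rw [integral_div, integral_finsetSum _ fun σ _ => hRi σ]
  have havg_le : ∫ S, signAvg (fun σ => R σ S) ∂P ≤ b := by
    have hi : Integrable (fun S => signAvg fun σ => R σ S) P :=
      (integrable_finsetSum _ fun σ _ => hRi σ).div_const _
    calc ∫ S, signAvg (fun σ => R σ S) ∂P ≤ ∫ _S, b ∂P :=
          integral_mono_ae hi (integrable_const b) hb
      _ = b := by simp
  have hfinal : ∫ Z, H₂ Z ∂PP ≤ 2 * b := by
    calc ∫ Z, H₂ Z ∂PP = signAvg (fun _ : Fin n → Bool => ∫ Z, H₂ Z ∂PP) :=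
          (signAvg_const _).symm
      _ ≤ signAvg (fun σ : Fin n → Bool => ∫ S, R σ S ∂P + ∫ S, R (fun j => !σ j) S ∂P) :=
          signAvg_mono hsign
      _ = 2 * ∫ S, signAvg (fun σ => R σ S) ∂P := by
          rw [signAvg_add, signAvg_not fun σ => ∫ S, R σ S ∂P, havg]; ring
      _ ≤ 2 * b := by gcongr
  calc ∫ S, maxDeviation μ g S ∂P ≤ (∫ p, H p ∂(P.prod P)) / n := hstep1
    _ ≤ (2 * b) / n := by rw [hpairs]; gcongr
    _ = 2 / n * b := by ring

end symmetrization

/-! ### The law of the tuples and the augmented loss -/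

section tuples
variable {𝒞 : Type*} {m k : ℕ}

theorem isProbabilityMeasure_negLaw {prior : PMF 𝒞} (hprior : ∀ c, prior c < 1)
    {D : 𝒞 → Measure (Vec m)} (hD : ∀ c, IsProbabilityMeasure (D c)) (c : 𝒞) :
    IsProbabilityMeasure (negLaw prior D c) := by
  constructor
  have h0 : ∑' z : {z : 𝒞 // z ≠ c}, prior z ≠ 0 := fun h => by
    rw [ENNReal.tsum_eq_zero] at h
    have h1 := prior.tsum_coe
    rw [tsum_eq_single c fun z hz => h ⟨z, hz⟩] at h1
    exact (hprior c).ne h1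
  have h1 : ∑' z : {z : 𝒞 // z ≠ c}, prior z ≠ ⊤ := by
    refine ne_top_of_le_ne_top ENNReal.one_ne_top ?_
    rw [← prior.tsum_coe]
    exact ENNReal.tsum_comp_le_tsum_of_injective Subtype.val_injective _
  rw [negLaw, Measure.smul_apply, Measure.sum_apply _ MeasurableSet.univ]
  simp only [Measure.smul_apply, measure_univ, smul_eq_mul, mul_one]
  exact ENNReal.inv_mul_cancel h0 h1

theorem isProbabilityMeasure_tupleLaw {prior : PMF 𝒞} (hprior : ∀ c, prior c < 1)
    {D : 𝒞 → Measure (Vec m)} (hD : ∀ c, IsProbabilityMeasure (D c)) (k : ℕ) :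
    IsProbabilityMeasure (tupleLaw prior D k) := by
  have := isProbabilityMeasure_negLaw hprior hD
  constructor
  rw [tupleLaw, Measure.sum_apply _ MeasurableSet.univ]
  simp only [Measure.smul_apply, measure_univ, smul_eq_mul, mul_one]
  exact prior.tsum_coe

/-- The `k + 2` vectors of an input tuple as an indexed family: `none` is the index of `x`,
`some none` that of `x⁺`, and `some (some i)` that of `x_i⁻`. -/
def entry (t : InputTuple m k) : Option (Option (Fin k)) → Vec m
  | none => t.1
  | some none => t.2.1
  | some (some i) => t.2.2 i

theorem entry_mem_entries (t : InputTuple m k) (e : Option (Option (Fin k))) :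
    entry t e ∈ entries t := by
  match e with
  | none => exact Or.inl (Or.inl rfl)
  | some none => exact Or.inl (Or.inr rfl)
  | some (some i) => exact Or.inr ⟨i, rfl⟩

theorem continuous_entry (e : Option (Option (Fin k))) :
    Continuous fun t : InputTuple m k => entry t e := by
  match e with
  | none => exact continuous_fst
  | some none => exact continuous_fst.comp continuous_snd
  | some (some i) => exact (continuous_apply i).comp (continuous_snd.comp continuous_snd)

theorem ae_norm_entry_le {prior : PMF 𝒞} (hprior : ∀ c, prior c < 1)
    {D : 𝒞 → Measure (Vec m)} (hD : ∀ c, IsProbabilityMeasure (D c)) {B : ℝ}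
    (hB : ∀ c, ∀ᵐ x ∂(D c), ‖x‖ ≤ B) :
    ∀ᵐ t ∂(tupleLaw prior D k), ∀ e, ‖entry t e‖ ≤ B := by
  have := isProbabilityMeasure_negLaw hprior hD
  have hneg : ∀ c, ∀ᵐ x ∂(negLaw prior D c), ‖x‖ ≤ B := fun c => by
    refine Measure.ae_smul_measure ?_ _
    rw [Measure.ae_sum_iff' (measurableSet_le measurable_norm measurable_const)]
    exact fun z => Measure.ae_smul_measure (hB z) _
  rw [ae_all_iff]
  intro e
  rw [tupleLaw, Measure.ae_sum_iff'
    (measurableSet_le (continuous_entry e).norm.measurable measurable_const)]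
  intro c
  refine Measure.ae_smul_measure ?_ _
  match e with
  | none => exact Measure.quasiMeasurePreserving_fst.ae (hB c)
  | some none =>
    refine Measure.quasiMeasurePreserving_snd.ae
      (p := fun y : Vec m × (Fin k → Vec m) => ‖y.1‖ ≤ B) ?_
    exact Measure.quasiMeasurePreserving_fst.ae (hB c)
  | some (some i) =>
    refine Measure.quasiMeasurePreserving_snd.ae
      (p := fun y : Vec m × (Fin k → Vec m) => ‖y.2 i‖ ≤ B) ?_
    refine Measure.quasiMeasurePreserving_snd.ae (p := fun y : Fin k → Vec m => ‖y i‖ ≤ B) ?_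
    exact (measurePreserving_eval (fun _ : Fin k => negLaw prior D c) i).quasiMeasurePreserving.ae
      (hneg c)

theorem norm_le_inputRadius {𝒳 : Set (Vec m)} (h : Bornology.IsBounded 𝒳) {x : Vec m}
    (hx : x ∈ 𝒳) : ‖x‖ ≤ inputRadius 𝒳 := by
  obtain ⟨C, hC⟩ := h.exists_norm_le
  exact le_csSup ⟨C, by rintro _ ⟨y, hy, rfl⟩; exact hC y hy⟩ ⟨x, hx, rfl⟩

theorem inputRadius_nonneg (𝒳 : Set (Vec m)) : 0 ≤ inputRadius 𝒳 :=
  Real.sSup_nonneg (by rintro _ ⟨y, _, rfl⟩; exact norm_nonneg y)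

end tuples

section loss
variable {q k : ℕ}

/-- The margins as a function of the outputs for the entries of a tuple. -/
noncomputable def outMargins (u : Option (Option (Fin k)) → Vec q) : Fin k → ℝ :=
  fun i => inner ℝ (u none) (u (some none) - u (some (some i)))

/-- The augmented loss of the outputs `u` for the entries of a tuple, where `‖u‖` is the maximum of
the Euclidean norms. It dominates the loss, agrees with it if `‖u‖ ≤ R`, and equals `1` if
`2 * R ≤ ‖u‖`, so that it is Lipschitz although the margins are quadratic in the outputs. -/
noncomputable def augLoss (loss : (Fin k → ℝ) → ℝ) (R : ℝ)
    (u : Option (Option (Fin k)) → Vec q) : ℝ :=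
  if 2 * R ≤ ‖u‖ then 1 else min 1 (loss (outMargins u) + max 0 (‖u‖ - R) / R)

variable {loss : (Fin k → ℝ) → ℝ} {R η : ℝ}

theorem augLoss_le_one (u : Option (Option (Fin k)) → Vec q) : augLoss loss R u ≤ 1 := by
  unfold augLoss; split_ifs
  · exact le_rfl
  · exact min_le_left _ _

theorem loss_le_augLoss (hR : 1 ≤ R) (h01 : ∀ v, 0 ≤ loss v ∧ loss v ≤ 1)
    (u : Option (Option (Fin k)) → Vec q) : loss (outMargins u) ≤ augLoss loss R u := by
  unfold augLoss; split_ifs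
  · exact (h01 _).2
  · exact le_min (h01 _).2 (le_add_of_nonneg_right
      (div_nonneg (le_max_left _ _) (by linarith)))

theorem augLoss_nonneg (hR : 1 ≤ R) (h01 : ∀ v, 0 ≤ loss v ∧ loss v ≤ 1)
    (u : Option (Option (Fin k)) → Vec q) : 0 ≤ augLoss loss R u :=
  (h01 _).1.trans (loss_le_augLoss hR h01 u)

theorem abs_augLoss_le_one (hR : 1 ≤ R) (h01 : ∀ v, 0 ≤ loss v ∧ loss v ≤ 1)
    (u : Option (Option (Fin k)) → Vec q) : |augLoss loss R u| ≤ 1 := by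
  rw [abs_of_nonneg (augLoss_nonneg hR h01 u)]
  exact augLoss_le_one u

theorem augLoss_le (hR : 1 ≤ R) (h01 : ∀ v, 0 ≤ loss v ∧ loss v ≤ 1)
    (u : Option (Option (Fin k)) → Vec q) :
    augLoss loss R u ≤ loss (outMargins u) + if R < ‖u‖ then 1 else 0 := by
  split_ifs with h
  · linarith [augLoss_le_one (loss := loss) (R := R) u, (h01 (outMargins u)).1]
  · push Not at h
    rw [augLoss, if_neg (by linarith), max_eq_left (by linarith), zero_div]
    exact min_le_right _ _

theorem norm_outMargins_sub_le (hR : 0 ≤ R) {u w : Option (Option (Fin k)) → Vec q}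
    (hu : ‖u‖ ≤ 2 * R) (hw : ‖w‖ ≤ 2 * R) :
    ‖outMargins u - outMargins w‖ ≤ 8 * R * ‖u - w‖ := by
  refine (pi_norm_le_iff_of_nonneg (by positivity)).2 fun i => ?_
  have hd : ∀ e, ‖u e - w e‖ ≤ ‖u - w‖ := fun e => norm_le_pi_norm (u - w) e
  have hu' : ∀ e, ‖u e‖ ≤ 2 * R := fun e => (norm_le_pi_norm u e).trans hu
  have hw' : ∀ e, ‖w e‖ ≤ 2 * R := fun e => (norm_le_pi_norm w e).trans hw
  have h1 : (outMargins u - outMargins w) i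
      = inner ℝ (u none - w none) (u (some none) - u (some (some i)))
        + inner ℝ (w none) ((u (some none) - w (some none))
          - (u (some (some i)) - w (some (some i)))) := by
    simp only [Pi.sub_apply, outMargins, inner_sub_left, inner_sub_right]; ring
  rw [h1, Real.norm_eq_abs]
  calc _ ≤ ‖u none - w none‖ * ‖u (some none) - u (some (some i))‖
        + ‖w none‖ * ‖(u (some none) - w (some none))
          - (u (some (some i)) - w (some (some i)))‖ :=
        (abs_add_le _ _).trans
          (add_le_add (abs_real_inner_le_norm _ _) (abs_real_inner_le_norm _ _))
    _ ≤ ‖u - w‖ * (2 * R + 2 * R) + 2 * R * (‖u - w‖ + ‖u - w‖) := by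
        gcongr
        · exact hd _
        · exact (norm_sub_le _ _).trans (add_le_add (hu' _) (hu' _))
        · exact hw' _
        · exact (norm_sub_le _ _).trans (add_le_add (hd _) (hd _))
    _ = 8 * R * ‖u - w‖ := by ring

theorem augLoss_sub_le (hR : 1 ≤ R) (hη : 1 ≤ η) (h01 : ∀ v, 0 ≤ loss v ∧ loss v ≤ 1)
    (hlip : ∀ v w, |loss v - loss w| ≤ η * ‖v - w‖) (u w : Option (Option (Fin k)) → Vec q) :
    augLoss loss R u - augLoss loss R w ≤ 9 * η * R * ‖u - w‖ := by
  have hR0 : 0 < R := by linarith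
  have hdiff : ‖u‖ ≤ ‖w‖ + ‖u - w‖ := by
    have := norm_add_le w (u - w); rwa [add_sub_cancel] at this
  have hD := norm_nonneg (u - w)
  have hηR : 1 ≤ η * R := by nlinarith
  have hDR : ‖u - w‖ / R ≤ η * R * ‖u - w‖ := by
    rw [div_le_iff₀ hR0]; nlinarith [mul_nonneg hD (sub_nonneg.2 hηR)]
  by_cases hw : 2 * R ≤ ‖w‖
  · have : augLoss loss R w = 1 := by rw [augLoss, if_pos hw]
    have h1 := augLoss_le_one (loss := loss) (R := R) u
    have : 0 ≤ 9 * η * R * ‖u - w‖ := by positivity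
    linarith
  have hwe : augLoss loss R w = min 1 (loss (outMargins w) + max 0 (‖w‖ - R) / R) := by
    rw [augLoss, if_neg hw]
  push Not at hw
  have hmono : max 0 (‖u‖ - R) / R ≤ max 0 (‖w‖ - R) / R + ‖u - w‖ / R := by
    rw [← add_div]
    gcongr
    refine max_le (add_nonneg (le_max_left _ _) hD) ?_
    linarith [le_max_right 0 (‖w‖ - R)]
  have key : augLoss loss R u ≤ loss (outMargins w) + max 0 (‖w‖ - R) / R
      + 9 * η * R * ‖u - w‖ := by
    by_cases hu : 2 * R ≤ ‖u‖
    · -- the ramp alone accounts for the value `1`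
      have h1 : 1 ≤ max 0 (‖u‖ - R) / R := by
        rw [le_div_iff₀ hR0]; linarith [le_max_right 0 (‖u‖ - R)]
      have h2 := augLoss_le_one (loss := loss) (R := R) u
      have h3 := (h01 (outMargins w)).1
      have : 0 ≤ η * R * ‖u - w‖ := by positivity
      linarith
    · have h1 : augLoss loss R u ≤ loss (outMargins u) + max 0 (‖u‖ - R) / R := by
        rw [augLoss, if_neg hu]; exact min_le_right _ _
      push Not at hu
      have h2 := (le_abs_self _).trans (hlip (outMargins u) (outMargins w))
      have h3 := norm_outMargins_sub_le hR0.le hu.le hw.le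
      have h4 : η * ‖outMargins u - outMargins w‖ ≤ η * (8 * R * ‖u - w‖) := by gcongr
      linarith
  rw [hwe, sub_le_comm]
  refine le_min ?_ ?_
  · have : 0 ≤ 9 * η * R * ‖u - w‖ := by positivity
    linarith [augLoss_le_one (loss := loss) (R := R) u]
  · linarith

theorem abs_augLoss_sub_le (hR : 1 ≤ R) (hη : 1 ≤ η) (h01 : ∀ v, 0 ≤ loss v ∧ loss v ≤ 1)
    (hlip : ∀ v w, |loss v - loss w| ≤ η * ‖v - w‖) (u w : Option (Option (Fin k)) → Vec q) :
    |augLoss loss R u - augLoss loss R w| ≤ 9 * η * R * ‖u - w‖ := by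
  refine abs_le'.2 ⟨augLoss_sub_le hR hη h01 hlip u w, ?_⟩
  rw [neg_sub, norm_sub_rev]
  exact augLoss_sub_le hR hη h01 hlip w u

theorem continuous_augLoss (hR : 1 ≤ R) (hη : 1 ≤ η) (h01 : ∀ v, 0 ≤ loss v ∧ loss v ≤ 1)
    (hlip : ∀ v w, |loss v - loss w| ≤ η * ‖v - w‖) :
    Continuous (augLoss (q := q) loss R) := by
  have hc : 0 ≤ 9 * η * R := by nlinarith
  refine (LipschitzWith.of_dist_le_mul (K := ⟨9 * η * R, hc⟩) fun u w => ?_).continuous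
  rw [Real.dist_eq, dist_eq_norm]
  exact abs_augLoss_sub_le hR hη h01 hlip u w

end loss

section deviation
variable {q m k n : ℕ} {loss : (Fin k → ℝ) → ℝ} {R η : ℝ}

/-- The augmented loss of the map `f` on the tuple `t`. -/
noncomputable def tupleLoss (loss : (Fin k → ℝ) → ℝ) (R : ℝ) (f : Vec m → Vec q)
    (t : InputTuple m k) : ℝ :=
  augLoss loss R fun e => f (entry t e)

theorem popRisk_le {μ : Measure (InputTuple m k)} [IsProbabilityMeasure μ] (hR : 1 ≤ R)
    (hη : 1 ≤ η) (h01 : ∀ v, 0 ≤ loss v ∧ loss v ≤ 1)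
    (hlip : ∀ v w, |loss v - loss w| ≤ η * ‖v - w‖) {f : Vec m → Vec q} (hf : Continuous f) :
    popRisk loss μ f ≤ ∫ t, tupleLoss loss R f t ∂μ := by
  have hloss : Continuous loss := by
    refine (LipschitzWith.of_dist_le_mul (K := ⟨η, by linarith⟩) fun u w => ?_).continuous
    rw [Real.dist_eq, dist_eq_norm]; exact hlip u w
  have hout : Continuous fun (t : InputTuple m k) e => f (entry t e) :=
    continuous_pi fun e => hf.comp (continuous_entry e)
  have hmar : Continuous fun t : InputTuple m k => margins f t := by
    refine continuous_pi fun i => ?_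
    exact (hf.comp continuous_fst).inner ((hf.comp (continuous_fst.comp continuous_snd)).sub
      (hf.comp ((continuous_apply i).comp (continuous_snd.comp continuous_snd))))
  refine integral_mono (integrable_of_abs_le (C := 1) (hloss.comp hmar).measurable fun t => ?_)
    (integrable_of_abs_le ((continuous_augLoss hR hη h01 hlip).comp hout).measurable
      fun t => abs_augLoss_le_one hR h01 _) fun t => ?_
  · simp only [abs_of_nonneg (h01 _).1]
    exact (h01 _).2
  · exact loss_le_augLoss hR h01 fun e => f (entry t e)

theorem mean_tupleLoss_le (hR : 1 ≤ R) (h01 : ∀ v, 0 ≤ loss v ∧ loss v ≤ 1)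
    (S : Fin n → InputTuple m k) (f : Vec m → Vec q) :
    (∑ j, tupleLoss loss R f (S j)) / n ≤ empRisk loss S f + (exceedCount S f R : ℝ) / n := by
  classical
  rw [empRisk, ← add_div]
  gcongr
  have hcount : (exceedCount S f R : ℝ)
      = ∑ j, if ∃ x ∈ entries (S j), R < ‖f x‖ then (1 : ℝ) else 0 := by
    rw [Finset.sum_boole, exceedCount, Set.ncard_eq_toFinset_card']
    simp
  rw [hcount, ← Finset.sum_add_distrib]
  refine Finset.sum_le_sum fun j _ => (augLoss_le hR h01 _).trans ?_
  refine add_le_add le_rfl ?_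
  split_ifs with h1 h2
  · exact le_rfl
  · -- if the maximum of the norms exceeds `R`, one of the entries does
    refine absurd h1 (not_lt.2 ?_)
    rw [pi_norm_le_iff_of_nonneg (by linarith)]
    exact fun e => not_lt.1 fun h => h2 ⟨_, entry_mem_entries _ e, h⟩
  · exact zero_le_one
  · exact le_rfl

end deviation

/-! ### The generalization bound -/

section class_bounds
variable {L : ℕ} {d : Fin (L + 1) → ℕ}
  {act : (l : Fin L) → Vec (d l.succ) → Vec (d l.succ)} {k n : ℕ}
  {loss : (Fin k → ℝ) → ℝ} {R η : ℝ}

/-- The scale of the chaining: up to a constant, the complexity `η R B ∏ ρ_l s_l (∑ …)^(3/2)`. -/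
noncomputable def chainScale (η R B : ℝ) (ρ : Fin L → NNReal) (a s : Fin L → ℝ) : ℝ :=
  72 * (η * R * B * (∏ l, (ρ l : ℝ) * s l) * ratioSum a s ^ (3 / 2 : ℝ))

theorem chainScale_nonneg (hR : 1 ≤ R) (hη : 1 ≤ η) {B : ℝ} (hB : 0 ≤ B) {ρ : Fin L → NNReal}
    {a s : Fin L → ℝ} (ha : ∀ l, 0 < a l) (hs : ∀ l, 0 < s l) :
    0 ≤ chainScale η R B ρ a s := by
  have h1 : 0 ≤ ∏ l, (ρ l : ℝ) * s l :=
    Finset.prod_nonneg fun l _ => mul_nonneg (ρ l).2 (hs l).le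
  have h2 : 0 ≤ ratioSum a s := Finset.sum_nonneg fun l _ =>
    div_nonneg (Real.rpow_nonneg (ha l).le _) (Real.rpow_nonneg (hs l).le _)
  have h3 : 0 ≤ ratioSum a s ^ (3 / 2 : ℝ) := Real.rpow_nonneg h2 _
  unfold chainScale
  positivity

theorem alphabet_le {W N : ℕ} (hN : 1 ≤ N) :
    ((W * (2 * N + 1) + 1 : ℕ) : ℝ) ≤ 4 * max (W : ℝ) 2 * N := by
  have h1 : (W : ℝ) ≤ max (W : ℝ) 2 := le_max_left _ _
  have h2 : (2 : ℝ) ≤ max (W : ℝ) 2 := le_max_right _ _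
  have h3 : (1 : ℝ) ≤ N := by exact_mod_cast hN
  push_cast
  calc (W : ℝ) * (2 * N + 1) + 1 ≤ max (W : ℝ) 2 * (2 * N + 1) + 1 := by gcongr
    _ ≤ 4 * max (W : ℝ) 2 * N := by nlinarith

/-- Bound on the empirical Rademacher averages (not divided by `n`) of the augmented losses of
finitely many networks. At the scale `t = 4 (∑ …)^(3/2) / 2 ^ j` the codes of the networks have
length at most `4 ^ j / 2`; for `j = 0` they are empty. -/
theorem signAvg_tupleLoss_le (hL : 1 ≤ L) (M : Weights d) {a s : Fin L → ℝ}
    {ρ : Fin L → NNReal} (hρ : ∀ l, LipschitzWith (ρ l) (act l)) (h0 : ∀ l, act l 0 = 0)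
    (ha : ∀ l, 0 < a l) (hs : ∀ l, 0 < s l) {B : ℝ} (hB : 0 ≤ B)
    (hR : 1 ≤ R) (hη : 1 ≤ η) (h01 : ∀ v, 0 ≤ loss v ∧ loss v ≤ 1)
    (hlip : ∀ v w, |loss v - loss w| ≤ η * ‖v - w‖) (hn : 1 ≤ n)
    {ι : Type*} [Fintype ι] [Nonempty ι] (A : ι → Weights d) (hA : ∀ i, A i ∈ weightSpace M a s)
    (S : Fin n → InputTuple (d 0) k) (hS : ∀ j e, ‖entry (S j) e‖ ≤ B) (J : ℕ) :
    signAvg (fun σ => Finset.univ.sup' Finset.univ_nonempty fun i =>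
        signSum σ fun j => tupleLoss loss R (network act (A i)) (S j))
      ≤ n * (chainScale η R B ρ a s / 2 ^ J) + J * (3 * chainScale η R B ρ a s * √n *
        √(2 * Real.log (4 * max (maxWidth d : ℝ) 2 * (n * (k + 2))))) := by
  have hV := ratioSum_pos hL ha hs
  set V₀ := ratioSum a s with hV₀
  set κ := Fin n × Option (Option (Fin k))
  have hcardκ : Fintype.card κ = n * (k + 2) := by
    simp [κ, Fintype.card_prod, Fintype.card_option, add_assoc]
  have hN : 1 ≤ n * (k + 2) := Nat.mul_pos hn (by omega)
  set ℓ := Real.log (4 * max (maxWidth d : ℝ) 2 * (n * (k + 2))) with hℓ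
  have hn1 : (1 : ℝ) ≤ n := by exact_mod_cast hn
  have hbig : (1 : ℝ) < 4 * max (maxWidth d : ℝ) 2 * (n * (k + 2)) := by
    have h2 : (2 : ℝ) ≤ max (maxWidth d : ℝ) 2 := le_max_right _ _
    have h3 : (1 : ℝ) ≤ n * (k + 2) := by exact_mod_cast hN
    nlinarith
  have hℓ0 : 0 < ℓ := Real.log_pos hbig
  have hQ : ((maxWidth d * (2 * Fintype.card κ + 1) + 1 : ℕ) : ℝ) ≤ Real.exp ℓ := by
    rw [hℓ, Real.exp_log (by linarith), hcardκ]
    exact (alphabet_le hN).trans (by push_cast; exact le_rfl)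
  have hsq : (V₀ ^ (3 / 2 : ℝ)) ^ 2 = V₀ ^ 3 := by
    rw [← Real.rpow_natCast, ← Real.rpow_mul hV.le, ← Real.rpow_natCast]; norm_num
  have hVp : 0 < V₀ ^ (3 / 2 : ℝ) := Real.rpow_pos_of_pos hV _
  have hcover : ∀ j : ℕ, ∃ (T : ℕ) (C : Finset (κ → Vec (d (Fin.last L)))),
      (T : ℝ) ≤ 4 ^ j / 2 ∧
      C.card ≤ (maxWidth d * (2 * Fintype.card κ + 1) + 1) ^ T ∧
      ∀ A ∈ weightSpace M a s, ∃ c ∈ C, ∀ p : κ, ‖network act A (entry (S p.1) p.2) - c p‖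
        ≤ (B * ∏ l, (ρ l : ℝ) * s l) * (4 * V₀ ^ (3 / 2 : ℝ) / 2 ^ j) := fun j => by
    obtain ⟨T, C, hT, hC, h⟩ := exists_network_cover hL M hρ h0 ha hs hB
      (fun p : κ => entry (S p.1) p.2) (fun p => hS p.1 p.2)
      (t := 4 * V₀ ^ (3 / 2 : ℝ) / 2 ^ j) (by positivity)
    refine ⟨T, C, hT.trans (le_of_eq ?_), hC, h⟩
    rw [div_pow, mul_pow, hsq, ← pow_mul, mul_comm j 2, pow_mul]
    norm_num
    field_simp
    rw [← hV₀]; ring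
  choose T C hT hC hCA using hcover
  choose c hcC hc using fun j i => hCA j (A i) (hA i)
  have hdiam : ∀ j i₁ i₂, c j i₁ = c j i₂ → ∀ p,
      |tupleLoss loss R (network act (A i₁)) (S p) - tupleLoss loss R (network act (A i₂)) (S p)|
        ≤ chainScale η R B ρ a s / 2 ^ j := fun j i₁ i₂ h p => by
    refine (abs_augLoss_sub_le hR hη h01 hlip _ _).trans ?_
    have hP : 0 ≤ B * ∏ l, (ρ l : ℝ) * s l :=
      mul_nonneg hB (Finset.prod_nonneg fun l _ => mul_nonneg (ρ l).2 (hs l).le)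
    have hnorm : ‖(fun e => network act (A i₁) (entry (S p) e))
        - fun e => network act (A i₂) (entry (S p) e)‖
        ≤ 2 * ((B * ∏ l, (ρ l : ℝ) * s l) * (4 * V₀ ^ (3 / 2 : ℝ) / 2 ^ j)) := by
      refine (pi_norm_le_iff_of_nonneg (by positivity)).2 fun e => ?_
      have h1 := hc j i₁ (p, e)
      have h2 := hc j i₂ (p, e)
      rw [← h, norm_sub_rev] at h2
      calc _ ≤ _ := norm_sub_le_norm_sub_add_norm_sub _ (c j i₁ (p, e)) _
        _ ≤ _ := by linarith
    calc 9 * η * R * _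
        ≤ 9 * η * R * (2 * ((B * ∏ l, (ρ l : ℝ) * s l) * (4 * V₀ ^ (3 / 2 : ℝ) / 2 ^ j))) := by
          gcongr
      _ = chainScale η R B ρ a s / 2 ^ j := by rw [chainScale, ← hV₀]; ring
  have hcard : ∀ j, ((C j).card : ℝ) ≤ Real.exp (4 ^ j / 2 * ℓ) := fun j => by
    calc ((C j).card : ℝ) ≤ ((maxWidth d * (2 * Fintype.card κ + 1) + 1 : ℕ) : ℝ) ^ T j := by
          exact_mod_cast hC j
      _ ≤ Real.exp ℓ ^ T j := by gcongr
      _ = Real.exp (T j * ℓ) := (Real.exp_nat_mul _ _).symm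
      _ ≤ Real.exp (4 ^ j / 2 * ℓ) := by gcongr; exact hT j
  refine signAvg_sup_le (fun i j => tupleLoss loss R (network act (A i)) (S j))
    (chainScale_nonneg hR hη hB ha hs) hℓ0 c hdiam (fun i₁ i₂ => ?_) C hcC hcard J
  have hT0 : T 0 = 0 := by
    have h1 := hT 0
    have h2 : (T 0 : ℝ) < 1 := by rw [pow_zero] at h1; linarith
    exact Nat.lt_one_iff.1 (by exact_mod_cast h2)
  have hC0 : (C 0).card ≤ 1 := by simpa [hT0] using hC 0
  exact Finset.card_le_one.1 hC0 _ (hcC 0 i₁) _ (hcC 0 i₂)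

/-- The numerical part: the chaining bound, divided by `n / 2`, for `J` with `n ≤ 2 ^ J ≤ 2 n`. -/
theorem chaining_bound_le {E W N : ℝ} (hE : 0 ≤ E) (hW : 2 ≤ W) {J : ℕ} (hn : 1 ≤ n)
    (hJ : (n : ℝ) ≤ 2 ^ J) (hJ' : (2 : ℝ) ^ J ≤ 2 * n) (hN : 2 * n ≤ N) :
    2 / n * (n * (E / 2 ^ J) + J * (3 * E * √n * √(2 * Real.log (4 * W * N))))
      ≤ 112 * Real.log N ^ 2 * (E / √n * Real.log W) := by
  have hn1 : (1 : ℝ) ≤ n := by exact_mod_cast hn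
  have hlog2 : (1 / 2 : ℝ) ≤ Real.log 2 := by linarith [Real.log_two_gt_d9]
  have hN2 : (2 : ℝ) ≤ N := by linarith
  have hw : (1 / 2 : ℝ) ≤ Real.log W := hlog2.trans (Real.log_le_log (by norm_num) hW)
  have hy2 : Real.log 2 ≤ Real.log N := Real.log_le_log (by norm_num) hN2
  have hlog : Real.log (4 * W * N) = 2 * Real.log 2 + Real.log W + Real.log N := by
    rw [Real.log_mul (by positivity) (by positivity), Real.log_mul (by norm_num) (by positivity),
      show (4 : ℝ) = 2 ^ 2 by norm_num, Real.log_pow]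
    norm_num
  have hJy : (J : ℝ) ≤ 2 * Real.log N := by
    have h1 : J * Real.log 2 ≤ Real.log N := by
      rw [← Real.log_pow]; exact Real.log_le_log (by positivity) (hJ'.trans hN)
    have : (0 : ℝ) ≤ J := Nat.cast_nonneg J
    nlinarith
  set w := Real.log W
  set y := Real.log N
  have hy : 1 / 2 ≤ y := hlog2.trans hy2
  have hwy : 1 / 4 ≤ w * y := by nlinarith
  have hsqrt : √(2 * Real.log (4 * W * N)) ≤ 8 * (w * y) := by
    rw [hlog, Real.sqrt_le_left (by positivity)]
    have h1 : w ≤ 2 * (w * y) := by nlinarith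
    have h2 : y ≤ 2 * (w * y) := by nlinarith
    nlinarith
  have hs0 : 0 < √(n : ℝ) := Real.sqrt_pos.2 (by linarith)
  have hsn : √(n : ℝ) ^ 2 = n := Real.sq_sqrt (by linarith)
  have hs1 : 1 ≤ √(n : ℝ) := by rw [Real.one_le_sqrt]; exact hn1
  have hfirst : n * (E / 2 ^ J) ≤ E * √n := by
    calc n * (E / 2 ^ J) ≤ n * (E / n) := by gcongr
      _ = E * 1 := by field_simp
      _ ≤ E * √n := by gcongr
  have hfac : 1 + J * (3 * √(2 * Real.log (4 * W * N))) ≤ 56 * (y ^ 2 * w) := by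
    have h1 : J * (3 * √(2 * Real.log (4 * W * N))) ≤ 2 * y * (3 * (8 * (w * y))) := by gcongr
    have h2 : 1 ≤ 8 * (y ^ 2 * w) := by nlinarith
    nlinarith
  calc 2 / n * (n * (E / 2 ^ J) + J * (3 * E * √n * √(2 * Real.log (4 * W * N))))
      ≤ 2 / n * (E * √n + J * (3 * E * √n * √(2 * Real.log (4 * W * N)))) := by gcongr
    _ = 2 * (E / √n) * (1 + J * (3 * √(2 * Real.log (4 * W * N)))) := by
        nth_rewrite 1 [← hsn]
        field_simp
    _ ≤ 2 * (E / √n) * (56 * (y ^ 2 * w)) := by gcongr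
    _ = _ := by ring

end class_bounds

section uniform
variable {L : ℕ} {d : Fin (L + 1) → ℕ}
  {act : (l : Fin L) → Vec (d l.succ) → Vec (d l.succ)} {k n : ℕ}
  {loss : (Fin k → ℝ) → ℝ} {R η : ℝ}

theorem continuous_tupleLoss_weights (hact : ∀ l, Continuous (act l))
    (hR : 1 ≤ R) (hη : 1 ≤ η) (h01 : ∀ v, 0 ≤ loss v ∧ loss v ≤ 1)
    (hlip : ∀ v w, |loss v - loss w| ≤ η * ‖v - w‖) (t : InputTuple (d 0) k) :
    Continuous fun A : Weights d => tupleLoss loss R (network act A) t := by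
  refine (continuous_augLoss hR hη h01 hlip).comp (continuous_pi fun e => ?_)
  exact (continuous_network hact).comp (Continuous.prodMk_left _)

theorem continuous_tupleLoss (hact : ∀ l, Continuous (act l))
    (hR : 1 ≤ R) (hη : 1 ≤ η) (h01 : ∀ v, 0 ≤ loss v ∧ loss v ≤ 1)
    (hlip : ∀ v w, |loss v - loss w| ≤ η * ‖v - w‖) (A : Weights d) :
    Continuous (tupleLoss (k := k) loss R (network act A)) := by
  refine (continuous_augLoss hR hη h01 hlip).comp (continuous_pi fun e => ?_)
  exact (continuous_network hact).comp (continuous_const.prodMk (continuous_entry e))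

/-- The generalization bound for the augmented losses of finitely many networks. -/
theorem measure_maxDeviation_le (hL : 1 ≤ L) (M : Weights d) {a s : Fin L → ℝ}
    {ρ : Fin L → NNReal} (hρ : ∀ l, LipschitzWith (ρ l) (act l)) (h0 : ∀ l, act l 0 = 0)
    (ha : ∀ l, 0 < a l) (hs : ∀ l, 0 < s l) {B : ℝ} (hB : 0 ≤ B)
    (hR : 1 ≤ R) (hη : 1 ≤ η) (h01 : ∀ v, 0 ≤ loss v ∧ loss v ≤ 1)
    (hlip : ∀ v w, |loss v - loss w| ≤ η * ‖v - w‖) (hn : 1 ≤ n)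
    (μ : Measure (InputTuple (d 0) k)) [IsProbabilityMeasure μ]
    (hμ : ∀ᵐ t ∂μ, ∀ e, ‖entry t e‖ ≤ B)
    {ι : Type*} [Fintype ι] [Nonempty ι] (A : ι → Weights d) (hA : ∀ i, A i ∈ weightSpace M a s)
    {δ : ℝ} (hδ : 0 < δ) (hδ1 : δ < 1) :
    (Measure.pi fun _ : Fin n => μ)
      {S | 112 * Real.log (n * (k + 2)) ^ 2 * (chainScale η R B ρ a s / √n
            * Real.log (max (maxWidth d : ℝ) 2)) + √(Real.log (1 / δ) / (2 * n))
          ≤ maxDeviation μ (fun i => tupleLoss loss R (network act (A i))) S}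
      ≤ ENNReal.ofReal δ := by
  have hact : ∀ l, Continuous (act l) := fun l => (hρ l).continuous
  have hg : ∀ i, Measurable (tupleLoss (k := k) loss R (network act (A i))) := fun i =>
    (continuous_tupleLoss hact hR hη h01 hlip (A i)).measurable
  have hg01 : ∀ i (t : InputTuple (d 0) k), 0 ≤ tupleLoss loss R (network act (A i)) t ∧
      tupleLoss loss R (network act (A i)) t ≤ 1 := fun i t =>
    ⟨augLoss_nonneg hR h01 _, augLoss_le_one _⟩
  have hg1 : ∀ i (t : InputTuple (d 0) k), |tupleLoss loss R (network act (A i)) t| ≤ 1 :=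
    fun i t => abs_augLoss_le_one hR h01 _
  have hS : ∀ᵐ S ∂(Measure.pi fun _ : Fin n => μ), ∀ j e, ‖entry (S j) e‖ ≤ B :=
    ae_all_iff.2 fun j =>
      (measurePreserving_eval (fun _ : Fin n => μ) j).quasiMeasurePreserving.ae hμ
  have hJ : (n : ℝ) ≤ 2 ^ Nat.clog 2 n := by exact_mod_cast Nat.le_pow_clog (by norm_num) n
  have hJ' : (2 : ℝ) ^ Nat.clog 2 n ≤ 2 * n := by
    rcases hn.eq_or_lt with rfl | h
    · norm_num
    · have h1 := Nat.pow_pred_clog_lt_self (b := 2) (by norm_num) h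
      have h2 : 0 < Nat.clog 2 n := Nat.clog_pos (by norm_num) h
      have h3 : 2 ^ Nat.clog 2 n ≤ 2 * n := by
        obtain ⟨c, hc⟩ := Nat.exists_eq_succ_of_ne_zero h2.ne'
        rw [hc] at h1 ⊢
        rw [Nat.pred_succ] at h1
        rw [pow_succ]; omega
      exact_mod_cast h3
  have hmean := (integral_maxDeviation_le μ hg hg1 hn (hS.mono fun S hS =>
    signAvg_tupleLoss_le hL M hρ h0 ha hs hB hR hη h01 hlip hn A hA S hS (Nat.clog 2 n))).trans
    (chaining_bound_le (chainScale_nonneg hR hη hB ha hs) (le_max_right _ _) hn hJ hJ' (by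
      have : (0 : ℝ) ≤ n * k := by positivity
      linarith))
  refine (measure_mono fun S hS => ?_).trans (measure_bounded_differences_le μ hn
    (measurable_maxDeviation (μ := μ) hg n) (abs_maxDeviation_le (μ := μ) hg1)
    (maxDeviation_update_le (μ := μ) hg01) hδ hδ1)
  simp only [Set.mem_ofPred_eq] at hS ⊢
  linarith

/-- Passage from finite families to a set of weights: by continuity in the weights, a deviation
larger than `τ` is attained at a point of a countable dense sequence. -/
theorem measure_exists_deviation_le (hact : ∀ l, Continuous (act l))
    (hR : 1 ≤ R) (hη : 1 ≤ η) (h01 : ∀ v, 0 ≤ loss v ∧ loss v ≤ 1)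
    (hlip : ∀ v w, |loss v - loss w| ≤ η * ‖v - w‖)
    (μ : Measure (InputTuple (d 0) k)) [IsProbabilityMeasure μ] (𝒜 : Set (Weights d))
    {τ : ℝ} {ε : ENNReal}
    (h : ∀ (m : ℕ) (A : Fin (m + 1) → Weights d), (∀ i, A i ∈ 𝒜) →
      (Measure.pi fun _ : Fin n => μ)
        {S | τ ≤ maxDeviation μ (fun i => tupleLoss loss R (network act (A i))) S} ≤ ε) :
    (Measure.pi fun _ : Fin n => μ)
      {S | ∃ A ∈ 𝒜, τ < ∫ t, tupleLoss loss R (network act A) t ∂μ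
        - (∑ j, tupleLoss loss R (network act A) (S j)) / n} ≤ ε := by
  rcases 𝒜.eq_empty_or_nonempty with rfl | hne
  · simp
  have : Nonempty 𝒜 := hne.to_subtype
  have : SecondCountableTopology (Weights d) :=
    inferInstanceAs (SecondCountableTopology
      ((l : Fin L) → Fin (d l.succ) → Fin (d l.castSucc) → ℝ))
  have hA : ∀ t, Continuous fun A : Weights d => tupleLoss (k := k) loss R (network act A) t :=
    continuous_tupleLoss_weights hact hR hη h01 hlip
  have hint : Continuous fun A : Weights d => ∫ t, tupleLoss (k := k) loss R (network act A) t ∂μ :=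
    continuous_of_dominated (bound := fun _ => 1)
      (fun A => (continuous_tupleLoss hact hR hη h01 hlip A).aestronglyMeasurable)
      (fun A => Filter.Eventually.of_forall fun t => abs_augLoss_le_one hR h01 _)
      (integrable_const _) (Filter.Eventually.of_forall hA)
  set dev : (Fin n → InputTuple (d 0) k) → Weights d → ℝ := fun S A =>
    ∫ t, tupleLoss loss R (network act A) t ∂μ
      - (∑ j, tupleLoss loss R (network act A) (S j)) / n with hdev
  have hdevc : ∀ S, Continuous (dev S) := fun S =>
    hint.sub ((continuous_finsetSum _ fun j _ => hA (S j)).div_const _)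
  set u : ℕ → Weights d := fun i => (TopologicalSpace.denseSeq 𝒜 i : Weights d) with hu
  have hsub : {S | ∃ A ∈ 𝒜, τ < dev S A} ⊆ ⋃ m : ℕ, {S | ∃ i ≤ m, τ < dev S (u i)} := by
    rintro S ⟨A, hA𝒜, hτ⟩
    have hopen : IsOpen {A : 𝒜 | τ < dev S A} :=
      isOpen_lt continuous_const ((hdevc S).comp continuous_subtype_val)
    obtain ⟨i, hi⟩ := (TopologicalSpace.denseRange_denseSeq 𝒜).exists_mem_open hopen
      ⟨⟨A, hA𝒜⟩, hτ⟩
    exact Set.mem_iUnion.2 ⟨i, i, le_rfl, hi⟩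
  have hmono : Monotone fun m : ℕ => {S | ∃ i ≤ m, τ < dev S (u i)} :=
    fun m m' hm S ⟨i, hi, h⟩ => ⟨i, hi.trans hm, h⟩
  refine (measure_mono hsub).trans ?_
  rw [hmono.measure_iUnion]
  refine iSup_le fun m => (measure_mono ?_).trans
    (h m (fun i => u i) fun i => (TopologicalSpace.denseSeq 𝒜 i).2)
  rintro S ⟨i, hi, hτ⟩
  exact hτ.le.trans (le_maxDeviation μ
    (fun i : Fin (m + 1) => tupleLoss loss R (network act (u i))) S ⟨i, Nat.lt_succ_of_le hi⟩)

end uniform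
end Contrastive

theorem theorem2 :
    -- absolute constants, which make the polylogarithmic factor explicit
    ∃ C : ℝ, 0 < C ∧ ∃ p : ℕ,
    -- the network class
    ∀ (L : ℕ) (_ : 1 ≤ L) (d : Fin (L + 1) → ℕ)
      (M : Contrastive.Weights d) (a s : Fin L → ℝ) (ρ : Fin L → NNReal)
      (act : (l : Fin L) → Contrastive.Vec (d l.succ) → Contrastive.Vec (d l.succ))
      (_ : ∀ l, 0 < a l) (_ : ∀ l, 0 < s l)
      (_ : ∀ l, LipschitzWith (ρ l) (act l)) (_ : ∀ l, act l 0 = 0)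
      -- the input space and the distribution of the tuples
      (𝒳 : Set (Contrastive.Vec (d 0))) (_ : Bornology.IsBounded 𝒳)
      (𝒞 : Type*) (prior : PMF 𝒞) (_ : ∀ c, prior c < 1)
      (D : 𝒞 → Measure (Contrastive.Vec (d 0))) (_ : ∀ c, IsProbabilityMeasure (D c))
      (_ : ∀ c, ∀ᵐ x ∂(D c), x ∈ 𝒳)
      -- the loss
      (k : ℕ) (loss : (Fin k → ℝ) → ℝ) (η : ℝ) (_ : 1 ≤ η)
      (_ : ∀ v, 0 ≤ loss v ∧ loss v ≤ 1)
      (_ : ∀ v w, |loss v - loss w| ≤ η * ‖v - w‖)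
      -- the threshold, the sample size and the confidence level
      (R : ℝ) (_ : 1 ≤ R) (n : ℕ) (_ : 1 ≤ n) (δ : ℝ) (_ : 0 < δ) (_ : δ < 1),
    (Measure.pi fun _ : Fin n => Contrastive.tupleLaw prior D k)
      {S | ¬ ∀ A ∈ Contrastive.weightSpace M a s,
        Contrastive.popRisk loss (Contrastive.tupleLaw prior D k) (Contrastive.network act A)
            - Contrastive.empRisk loss S (Contrastive.network act A)
          ≤ (Contrastive.exceedCount S (Contrastive.network act A) R : ℝ) / n
            + 3 * Real.sqrt (Real.log (2 / δ) / (2 * n))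
            + C * Real.log (n * (k + 2)) ^ p
              * (η * R * Contrastive.inputRadius 𝒳 / Real.sqrt n
                * Real.log (max (Contrastive.maxWidth d) 2)
                * (∏ l, (ρ l : ℝ) * s l)
                * (∑ l, a l ^ (2 / 3 : ℝ) / s l ^ (2 / 3 : ℝ)) ^ (3 / 2 : ℝ))}
      ≤ ENNReal.ofReal δ := by
  refine ⟨112 * 72, by norm_num, 2, ?_⟩
  intro L hL d M a s ρ act ha hs hρ h0 𝒳 h𝒳 𝒞 prior hprior D hD hD𝒳 k loss η hη h01 hlip R hR
    n hn δ hδ hδ1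
  have := Contrastive.isProbabilityMeasure_tupleLaw hprior hD k
  have hact : ∀ l, Continuous (act l) := fun l => (hρ l).continuous
  have hμ := Contrastive.ae_norm_entry_le (k := k) hprior hD fun c =>
    (hD𝒳 c).mono fun x hx => Contrastive.norm_le_inputRadius h𝒳 hx
  have hmain := Contrastive.measure_exists_deviation_le (n := n) hact hR hη h01 hlip
    (Contrastive.tupleLaw prior D k) (Contrastive.weightSpace M a s) fun m A hA =>
    Contrastive.measure_maxDeviation_le hL M hρ h0 ha hs (Contrastive.inputRadius_nonneg 𝒳) hR hη
      h01 hlip hn (Contrastive.tupleLaw prior D k) hμ A hA hδ hδ1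
  refine (measure_mono fun S hS => ?_).trans hmain
  simp only [Set.mem_ofPred_eq, not_forall, not_le] at hS ⊢
  obtain ⟨A, hA, hlt⟩ := hS
  refine ⟨A, hA, ?_⟩
  have hcont : Continuous (Contrastive.network act A) :=
    (Contrastive.continuous_network hact).comp (continuous_const.prodMk continuous_id)
  have h1 := Contrastive.popRisk_le (μ := Contrastive.tupleLaw prior D k) hR hη h01 hlip hcont
  have h2 := Contrastive.mean_tupleLoss_le hR h01 S (Contrastive.network act A)
  have hconf : √(Real.log (1 / δ) / (2 * n)) ≤ 3 * √(Real.log (2 / δ) / (2 * n)) := by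
    have h3 : √(Real.log (1 / δ) / (2 * n)) ≤ √(Real.log (2 / δ) / (2 * n)) := by
      gcongr; norm_num
    linarith [Real.sqrt_nonneg (Real.log (2 / δ) / (2 * n))]
  have hscale : 112 * Real.log (n * (k + 2)) ^ 2
        * (Contrastive.chainScale η R (Contrastive.inputRadius 𝒳) ρ a s / √n
          * Real.log (max (Contrastive.maxWidth d : ℝ) 2))
      = 112 * 72 * Real.log (n * (k + 2)) ^ 2
        * (η * R * Contrastive.inputRadius 𝒳 / √n
          * Real.log (max (Contrastive.maxWidth d : ℝ) 2) * (∏ l, (ρ l : ℝ) * s l)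
          * (∑ l, a l ^ (2 / 3 : ℝ) / s l ^ (2 / 3 : ℝ)) ^ (3 / 2 : ℝ)) := by
    rw [Contrastive.chainScale, Contrastive.ratioSum]; ring
  linarith
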